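/- Theorem 4.2. Let $X$ and $Y$ be Polish spaces with Borel probability measures $\mu$ and $\nu$, and let $c:X\times Y\to[0,\infty]$ be Borel measurable. Let $\Pi(\mu,\nu)$ be the set of Borel measures on $X\times Y$ with marginals $\mu,\nu$, write $\langle c,\pi\rangle=\int c\,d\pi$, let $\Pi(\mu,\nu,c)=\{\pi\in\Pi(\mu,\nu):\langle c,\pi\rangle<\infty\}$, assumed non-empty, and $P=\inf\{\langle c,\pi\rangle:\pi\in\Pi(\mu,\nu)\}$. Write $\pi_1\preceq\pi_2$ if $\pi_1\ll\pi_2$ and $\big\|\frac{d\pi_1}{d\pi_2}\big\|_{L^\infty(\pi_2)}<\infty$. For $\pi\in\Pi(\mu,\nu,c)$ put $$P^{(\pi)}=\inf\{\langle c,\pi'\rangle:\pi'\in\Pi(\mu,\nu),\ \pi'\preceq\pi\},$$ $$D^{(\pi)}=\lim_{\varepsilon\downarrow0}\sup\Big\{\int\phi\,d\mu+\int\psi\,d\nu:\ \phi\in L^1(\mu),\ \psi\in L^1(\nu),\ \int(\phi\oplus\psi-c)_+\,d\pi\le\varepsilon\Big\},$$ where $(\phi\oplus\psi)(x,y)=\phi(x)+\psi(y)$.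 Let $L^1_S(\pi)$ be the closed linear span in $L^1(\pi)$ of all $\phi\oplus\psi$ with $\phi\in L^1(\mu)$, $\psi\in L^1(\nu)$; regard $L^1_S(\pi)^{**}$ as a subspace of $L^1(\pi)^{**}=L^\infty(\pi)^*$ (a space of finitely additive measures, with its Banach lattice order), identify $c$ with an element of $L^1(\pi)\subseteq L^1(\pi)^{**}$ and $\pi$ with the constant $1\in L^\infty(\pi)$, and put $$D^{(\pi)}_{**}=\sup\{\langle h,\pi\rangle:\ h\in L^1_S(\pi)^{**},\ h\le c\text{ in }L^1(\pi)^{**}\}.$$ For $\pi_1\preceq\pi_2$ let $P_{\pi_1,\pi_2}:L^1(\pi_2)\to L^1(\pi_1)$ be the natural projection (the class of $f$ modulo $\pi_2$-null functions goes to its class modulo $\pi_1$-null functions). Let $\pi_0\in\Pi(\mu,\nu,c)$ satisfy $P^{(\pi_0)}=\inf_{\pi\in\Pi(\mu,\nu,c)}P^{(\pi)}$. Then there is a family $\hat H=(\hat h_\pi)$, indexed by the $\pi\in\Pi(\mu,\nu,c)$ with $\pi\succeq\pi_0$, which belongs to the projective limit of the spaces $L^1(\pi)^{**}$, that is, $\hat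 h_\pi\in L^1(\pi)^{**}$ and $P_{\pi_1,\pi_2}^{**}(\hat h_{\pi_2})=\hat h_{\pi_1}$ whenever $\pi_0\preceq\pi_1\preceq\pi_2$, such that for each such $\pi$: - $\hat h_\pi\in L^1_S(\pi)^{**}$, $\hat h_\pi\le c$ in $L^1(\pi)^{**}$, and $\langle\hat h_\pi,\pi\rangle=D^{(\pi)}_{**}$; - in the unique decomposition $\hat h_\pi=\hat h^r_\pi+\hat h^s_\pi$ into a regular part $\hat h^r_\pi\in L^1(\pi)$ and a purely singular (purely finitely additive) part $\hat h^s_\pi\in L^1(\pi)^{**}$ one has $\hat h^r_\pi\le c$ in $L^1(\pi)$ and $\hat h^s_\pi\le0$. Moreover, for each $\pi\in\Pi(\mu,\nu,c)$ with $\pi\succeq\pi_0$ the limit defining $D^{(\pi)}$ exists and $$D^{(\pi)}_{**}=D^{(\pi)}=P^{(\pi)}=P^{(\pi_0)}.$$ If in addition $P$ is attained by some $\pi\in\Pi(\mu,\nu)$, which is the case for instance if $c$ is lower semicontinuous, then $D^{(\pi)}_{**}=D^{(\pi)}=P^{(\pi)}=P$ for each such $\pi$. -/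

import Mathlib

open MeasureTheory Filter Topology
open scoped ENNReal

namespace TransportBidual

noncomputable section

/-! ### Transport plans and primal values -/

section Plans

variable {X Y : Type*} [MeasurableSpace X] [MeasurableSpace Y]

/-- `Π(μ, ν)`: the measures on `X × Y` with marginals `μ` and `ν`. -/
def plans (μ : Measure X) (ν : Measure Y) : Set (Measure (X × Y)) :=
  {π | π.fst = μ ∧ π.snd = ν}

/-- `Π(μ, ν, c)`: the transport plans of finite cost. -/
def finitePlans (μ : Measure X) (ν : Measure Y) (c : X × Y → ℝ≥0∞) : Set (Measure (X × Y)) :=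
  {π | π ∈ plans μ ν ∧ ∫⁻ z, c z ∂π ≠ ∞}

/-- `π₁ ⪯ π₂`: absolute continuity with an essentially bounded density. -/
def PlanLE {Z : Type*} [MeasurableSpace Z] (π₁ π₂ : Measure Z) : Prop :=
  π₁ ≪ π₂ ∧ essSup (π₁.rnDeriv π₂) π₂ < ∞

/-- The primal value `P`. -/
def primal (μ : Measure X) (ν : Measure Y) (c : X × Y → ℝ≥0∞) : ℝ≥0∞ :=
  ⨅ π ∈ plans μ ν, ∫⁻ z, c z ∂π

/-- The primal problem has an optimizer. -/
def PrimalAttained (μ : Measure X) (ν : Measure Y) (c : X × Y → ℝ≥0∞) : Prop :=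
  ∃ π ∈ plans μ ν, ∫⁻ z, c z ∂π = primal μ ν c

/-- `P^(π)`: the infimum of the cost over the plans with bounded density with respect to `π`. -/
def primalAt (μ : Measure X) (ν : Measure Y) (c : X × Y → ℝ≥0∞) (π : Measure (X × Y)) : ℝ≥0∞ :=
  ⨅ π' ∈ {π' | π' ∈ plans μ ν ∧ PlanLE π' π}, ∫⁻ z, c z ∂π'

/-- `D^(π, ε)`. The integrand of the constraint is `(φ ⊕ ψ - c)₊`: as `c ≥ 0`, it equals
`(φ ⊕ ψ)₊ - c` with the truncated subtraction of `ℝ≥0∞`. -/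
def dualEps (μ : Measure X) (ν : Measure Y) (c : X × Y → ℝ≥0∞) (π : Measure (X × Y)) (ε : ℝ) :
    EReal :=
  ⨆ p ∈ {p : (X → ℝ) × (Y → ℝ) | Integrable p.1 μ ∧ Integrable p.2 ν ∧
      ∫⁻ z, (ENNReal.ofReal (p.1 z.1 + p.2 z.2) - c z) ∂π ≤ ENNReal.ofReal ε},
    ((∫ x, p.1 x ∂μ + ∫ y, p.2 y ∂ν : ℝ) : EReal)

/-- `D^(π)`, the limit of `D^(π, ε)` as `ε` decreases to `0`. -/
def dualAt (μ : Measure X) (ν : Measure Y) (c : X × Y → ℝ≥0∞) (π : Measure (X × Y)) : EReal :=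
  limUnder (𝓝[>] (0 : ℝ)) (dualEps μ ν c π)

end Plans

/-! ### Biduals -/

/-- The bidual of a normed space. -/
abbrev Bidual (E : Type*) [NormedAddCommGroup E] [NormedSpace ℝ E] : Type _ :=
  StrongDual ℝ (StrongDual ℝ E)

/-- The second transpose `T** : E** → F**`, that is `T** g = (ℓ ↦ g (ℓ ∘ T))`. -/
def bidualMap {E F : Type*} [NormedAddCommGroup E] [NormedSpace ℝ E]
    [NormedAddCommGroup F] [NormedSpace ℝ F] (T : E →L[ℝ] F) : Bidual E →L[ℝ] Bidual F :=
  ContinuousLinearMap.precomp ℝ (ContinuousLinearMap.precomp ℝ T)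

section L1

variable {Z : Type*} [MeasurableSpace Z] {π : Measure Z}

/-- The canonical embedding `L¹(π) → L¹(π)**`. -/
def toBidual (f : Lp ℝ 1 π) : Bidual (Lp ℝ 1 π) :=
  NormedSpace.inclusionInDoubleDual ℝ (Lp ℝ 1 π) f

/-- The order of the Banach lattice `L¹(π)**`: comparison on the positive functionals. -/
def BidualLE (g h : Bidual (Lp ℝ 1 π)) : Prop :=
  ∀ ℓ : StrongDual ℝ (Lp ℝ 1 π), (∀ f : Lp ℝ 1 π, 0 ≤ f → 0 ≤ ℓ f) → g ℓ ≤ h ℓ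

/-- `⟨h, π⟩`: the measure `π` is the constant `1` of `L^∞(π) = L¹(π)*`, i.e. integration. -/
def pairing (h : Bidual (Lp ℝ 1 π)) : ℝ :=
  h L1.integralCLM

/-- `g` is purely singular (purely finitely additive): it is a difference of two positive elements
neither of which dominates a nonzero positive element of `L¹(π)`. -/
def IsPurelySingular (g : Bidual (Lp ℝ 1 π)) : Prop :=
  ∃ g₁ g₂ : Bidual (Lp ℝ 1 π), g = g₁ - g₂ ∧ BidualLE 0 g₁ ∧ BidualLE 0 g₂ ∧
    (∀ f : Lp ℝ 1 π, 0 ≤ f → BidualLE (toBidual f) g₁ → f = 0) ∧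
    (∀ f : Lp ℝ 1 π, 0 ≤ f → BidualLE (toBidual f) g₂ → f = 0)

/-- `h = r + s` is the decomposition of `h` into its regular and purely singular parts. -/
def IsRegularSingular (h : Bidual (Lp ℝ 1 π)) (r : Lp ℝ 1 π) (s : Bidual (Lp ℝ 1 π)) : Prop :=
  h = toBidual r + s ∧ IsPurelySingular s

/-- The cost, finite `π`-almost everywhere when its integral is finite, as an element of
`L¹(π)`. -/
def costL1 (c : Z → ℝ≥0∞) (hc : Measurable c) (hπ : ∫⁻ z, c z ∂π ≠ ∞) : Lp ℝ 1 π :=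
  Integrable.toL1 (fun z => (c z).toReal)
    (integrable_toReal_of_lintegral_ne_top hc.aemeasurable hπ)

end L1

section L1S

variable {X Y : Type*} [MeasurableSpace X] [MeasurableSpace Y]

/-- `L¹_S(π)`: the closed span in `L¹(π)` of the functions `φ ⊕ ψ` with `φ ∈ L¹(μ)`,
`ψ ∈ L¹(ν)`. -/
def L1S (μ : Measure X) (ν : Measure Y) (π : Measure (X × Y)) : Submodule ℝ (Lp ℝ 1 π) :=
  (Submodule.span ℝ {f : Lp ℝ 1 π | ∃ (φ : X → ℝ) (ψ : Y → ℝ), Integrable φ μ ∧ Integrable ψ ν ∧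
    f =ᵐ[π] fun z => φ z.1 + ψ z.2}).topologicalClosure

/-- `L¹_S(π)**` as a subspace of `L¹(π)**`: the image of the second transpose of the inclusion
`L¹_S(π) → L¹(π)`. -/
def bidualL1S (μ : Measure X) (ν : Measure Y) (π : Measure (X × Y)) :
    Set (Bidual (Lp ℝ 1 π)) :=
  Set.range (bidualMap (L1S μ ν π).subtypeL)

/-- The feasible set of the bidual dual problem: `h ∈ L¹_S(π)**` with `h ≤ c` in `L¹(π)**`. -/
def bidualFeasible (μ : Measure X) (ν : Measure Y) (c : X × Y → ℝ≥0∞) (hc : Measurable c)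
    (π : Measure (X × Y)) (hπ : ∫⁻ z, c z ∂π ≠ ∞) : Set (Bidual (Lp ℝ 1 π)) :=
  {h | h ∈ bidualL1S μ ν π ∧ BidualLE h (toBidual (costL1 c hc hπ))}

/-- `D_{**}^(π)`, the value of the bidual dual problem. -/
def dualBidual (μ : Measure X) (ν : Measure Y) (c : X × Y → ℝ≥0∞) (hc : Measurable c)
    (π : Measure (X × Y)) (hπ : ∫⁻ z, c z ∂π ≠ ∞) : EReal :=
  ⨆ h ∈ bidualFeasible μ ν c hc π hπ, (pairing h : EReal)

end L1S

/-! ### Projections and the projective limit -/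

section Projection

variable {Z : Type*} [MeasurableSpace Z] {π₁ π₂ : Measure Z}

theorem PlanLE.le_smul [IsFiniteMeasure π₁] [IsFiniteMeasure π₂] (h : PlanLE π₁ π₂) :
    π₁ ≤ essSup (π₁.rnDeriv π₂) π₂ • π₂ := by
  conv_lhs => rw [← Measure.withDensity_rnDeriv_eq π₁ π₂ h.1]
  rw [← withDensity_const]
  exact withDensity_mono (ENNReal.ae_le_essSup _)

theorem PlanLE.memLp [IsFiniteMeasure π₁] [IsFiniteMeasure π₂] (h : PlanLE π₁ π₂)
    (f : Lp ℝ 1 π₂) : MemLp f 1 π₁ :=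
  (Lp.memLp f).of_measure_le_smul h.2.ne h.le_smul

/-- The projection `P_{π₁,π₂} : L¹(π₂) → L¹(π₁)` for `π₁ ⪯ π₂`: it sends the class of a function
modulo `π₂`-null functions to its class modulo `π₁`-null functions. -/
def proj [IsFiniteMeasure π₁] [IsFiniteMeasure π₂] (h : PlanLE π₁ π₂) :
    Lp ℝ 1 π₂ →L[ℝ] Lp ℝ 1 π₁ :=
  LinearMap.mkContinuous
    { toFun := fun f => (h.memLp f).toLp f
      map_add' := fun f g => by
        rw [← MemLp.toLp_add, MemLp.toLp_eq_toLp_iff]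
        exact h.1.ae_eq (Lp.coeFn_add f g)
      map_smul' := fun a f => by
        rw [RingHom.id_apply, ← MemLp.toLp_const_smul, MemLp.toLp_eq_toLp_iff]
        exact h.1.ae_eq (Lp.coeFn_smul a f) }
    (essSup (π₁.rnDeriv π₂) π₂).toReal
    (fun f => by
      simp only [LinearMap.coe_mk, AddHom.coe_mk]
      rw [Lp.norm_toLp, Lp.norm_def, ← ENNReal.toReal_mul]
      refine ENNReal.toReal_mono (ENNReal.mul_ne_top h.2.ne (Lp.eLpNorm_ne_top f)) ?_
      refine (eLpNorm_mono_measure f h.le_smul).trans ?_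
      rw [eLpNorm_one_smul_measure])

end Projection

section Limit

variable {X Y : Type*} [MeasurableSpace X] [MeasurableSpace Y]

/-- The index set of the limit: the finite-cost plans `π` with `π ⪰ π₀`. -/
abbrev PlansAbove (μ : Measure X) (ν : Measure Y) (c : X × Y → ℝ≥0∞) (π₀ : Measure (X × Y)) :
    Type _ :=
  {π : Measure (X × Y) // π ∈ finitePlans μ ν c ∧ PlanLE π₀ π}

instance plansAbove_isProbabilityMeasure {μ : Measure X} {ν : Measure Y} [IsProbabilityMeasure μ] {c : X × Y → ℝ≥0∞}
    {π₀ : Measure (X × Y)} (π : PlansAbove μ ν c π₀) : IsProbabilityMeasure π.1 :=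
  ⟨by rw [← Measure.fst_univ, π.2.1.1.1]; exact measure_univ⟩

/-- Membership in the projective limit of the spaces `L¹(π)**`, `π ⪰ π₀`, along the second
transposes of the projections `P_{π₁,π₂}`. -/
def IsProjectiveFamily {μ : Measure X} {ν : Measure Y} [IsProbabilityMeasure μ]
    {c : X × Y → ℝ≥0∞} {π₀ : Measure (X × Y)}
    (H : ∀ π : PlansAbove μ ν c π₀, Bidual (Lp ℝ 1 π.1)) : Prop :=
  ∀ (π₁ π₂ : PlansAbove μ ν c π₀) (h : PlanLE π₁.1 π₂.1), bidualMap (proj h) (H π₂) = H π₁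

end Limit

end

end TransportBidual

namespace TransportBidual

noncomputable section

section Functionals

variable {Z : Type*} [MeasurableSpace Z] {π : Measure Z}

/-- A finitely additive set function dominated by a finite measure is a measure. -/
theorem exists_measure_of_additive_le (κ : Measure Z) [IsFiniteMeasure κ] (m : Set Z → ℝ≥0∞)
    (hadd : ∀ A B, MeasurableSet A → MeasurableSet B → Disjoint A B → m (A ∪ B) = m A + m B)
    (hle : ∀ A, MeasurableSet A → m A ≤ κ A) :
    ∃ ρ : Measure Z, ρ ≤ κ ∧ ∀ A, MeasurableSet A → ρ A = m A := by
  have h0 : m ∅ = 0 := by simpa using hle ∅ MeasurableSet.empty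
  have hU : ∀ ⦃f : ℕ → Set Z⦄, (∀ i, MeasurableSet (f i)) → Pairwise (Function.onFun Disjoint f) →
      m (⋃ i, f i) = ∑' i, m (f i) := by
    intro f hf hd
    have hacc : ∀ n, MeasurableSet (⋃ i ∈ Finset.range n, f i) := fun n =>
      Finset.measurableSet_biUnion _ fun i _ => hf i
    have hfin : ∀ n, m (⋃ i ∈ Finset.range n, f i) = ∑ i ∈ Finset.range n, m (f i) := by
      intro n
      induction n with
      | zero => simpa using h0
      | succ n ih =>
        rw [Finset.sum_range_succ, ← ih, ← hadd _ _ (hacc n) (hf n)]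
        · congr 1
          simp only [Finset.range_add_one, Finset.mem_insert, Set.iUnion_iUnion_eq_or_left]
          rw [Set.union_comm]
        · simp only [Set.disjoint_iUnion_left]
          intro i hi
          exact hd (Finset.mem_range.1 hi).ne
    have hsplit : ∀ n, m (⋃ i, f i) = ∑ i ∈ Finset.range n, m (f i) +
        m ((⋃ i, f i) \ ⋃ i ∈ Finset.range n, f i) := by
      intro n
      rw [← hfin n, ← hadd _ _ (hacc n) ((MeasurableSet.iUnion hf).diff (hacc n))
        Set.disjoint_sdiff_right, Set.union_sdiff_cancel]
      exact Set.iUnion₂_subset fun i _ => Set.subset_iUnion f i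
    have htail : Tendsto (fun n => m ((⋃ i, f i) \ ⋃ i ∈ Finset.range n, f i)) atTop (𝓝 0) := by
      have hk : Tendsto (fun n => κ ((⋃ i, f i) \ ⋃ i ∈ Finset.range n, f i)) atTop (𝓝 0) := by
        have := tendsto_measure_iInter_atTop (μ := κ)
          (s := fun n => (⋃ i, f i) \ ⋃ i ∈ Finset.range n, f i)
          (fun n => ((MeasurableSet.iUnion hf).diff (hacc n)).nullMeasurableSet)
          (fun a b hab => Set.sdiff_subset_sdiff_right
            (Set.biUnion_subset_biUnion_left (by simpa using hab)))
          ⟨0, measure_ne_top _ _⟩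
        suffices hemp : ⋂ n, ((⋃ i, f i) \ ⋃ i ∈ Finset.range n, f i) = ∅ by
          rwa [hemp, measure_empty] at this
        ext z
        simp only [Set.mem_iInter, Set.mem_sdiff, Set.mem_iUnion, Finset.mem_range, not_exists,
          Set.mem_empty_iff_false, iff_false, not_forall, exists_prop]
        by_cases hz : ∃ i, z ∈ f i
        · obtain ⟨i, hi⟩ := hz
          exact ⟨i + 1, fun h => h.2 i ⟨Nat.lt_succ_self i, hi⟩⟩
        · exact ⟨0, fun h => hz h.1⟩
      exact tendsto_of_tendsto_of_tendsto_of_le_of_le tendsto_const_nhds hk (fun _ => zero_le)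
        fun n => hle _ ((MeasurableSet.iUnion hf).diff (hacc n))
    have hlim := (ENNReal.tendsto_nat_tsum fun i => m (f i)).add htail
    rw [add_zero] at hlim
    refine tendsto_nhds_unique ?_ hlim
    simp_rw [← hsplit]
    exact tendsto_const_nhds
  refine ⟨Measure.ofMeasurable (fun A _ => m A) h0 hU, ?_, fun A hA =>
    Measure.ofMeasurable_apply A hA⟩
  refine Measure.le_iff.2 fun A hA => ?_
  rw [Measure.ofMeasurable_apply A hA]
  exact hle A hA

theorem PlanLE.of_le_smul {ρ : Measure Z} [IsFiniteMeasure ρ] [IsFiniteMeasure π] {C : ℝ≥0∞}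
    (hC : C ≠ ∞) (h : ρ ≤ C • π) : PlanLE ρ π := by
  refine ⟨Measure.absolutelyContinuous_of_le_smul h, lt_of_le_of_lt ?_ hC.lt_top⟩
  refine essSup_le_of_ae_le _ ?_
  refine ae_le_of_forall_setLIntegral_le_of_sigmaFinite (Measure.measurable_rnDeriv _ _) ?_
  intro s hs _
  calc ∫⁻ x in s, ρ.rnDeriv π x ∂π ≤ ρ s := Measure.setLIntegral_rnDeriv_le s
    _ ≤ (C • π) s := h s
    _ = ∫⁻ x in s, C ∂π := by simp

theorem PlanLE.refl [IsFiniteMeasure π] : PlanLE π π :=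
  PlanLE.of_le_smul ENNReal.one_ne_top (by simp)

theorem PlanLE.trans {π₁ π₂ π₃ : Measure Z} [IsFiniteMeasure π₁] [IsFiniteMeasure π₂]
    [IsFiniteMeasure π₃] (h₁ : PlanLE π₁ π₂) (h₂ : PlanLE π₂ π₃) : PlanLE π₁ π₃ := by
  refine PlanLE.of_le_smul (ENNReal.mul_ne_top h₁.2.ne h₂.2.ne)
    (h₁.le_smul.trans ?_)
  rw [mul_smul]
  exact Measure.le_iff.2 fun A _ => by
    simp only [Measure.smul_apply, smul_eq_mul]
    gcongr
    exact h₂.le_smul A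

theorem PlanLE.restrict [IsFiniteMeasure π] (A : Set Z) : PlanLE (π.restrict A) π :=
  PlanLE.of_le_smul ENNReal.one_ne_top (by simpa using Measure.restrict_le_self)

theorem proj_ae_eq {π₁ π₂ : Measure Z} [IsFiniteMeasure π₁] [IsFiniteMeasure π₂]
    (h : PlanLE π₁ π₂) (f : Lp ℝ 1 π₂) : proj h f =ᵐ[π₁] f :=
  MemLp.coeFn_toLp (h.memLp f)

/-- Integration against a measure with bounded density, as an element of `L¹(π)*`. -/
def intFun {ρ : Measure Z} [IsFiniteMeasure ρ] [IsFiniteMeasure π] (h : PlanLE ρ π) :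
    StrongDual ℝ (Lp ℝ 1 π) :=
  L1.integralCLM.comp (proj h)

theorem integralCLM_apply (f : Lp ℝ 1 π) :
    (L1.integralCLM : StrongDual ℝ (Lp ℝ 1 π)) f = ∫ z, f z ∂π := by
  rw [← L1.integral_eq, L1.integral_eq_integral]

theorem intFun_apply {ρ : Measure Z} [IsFiniteMeasure ρ] [IsFiniteMeasure π] (h : PlanLE ρ π)
    (f : Lp ℝ 1 π) : intFun h f = ∫ z, f z ∂ρ := by
  rw [intFun, ContinuousLinearMap.comp_apply, integralCLM_apply]
  exact integral_congr_ae (proj_ae_eq h f)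

theorem PlanLE.integrable {ρ : Measure Z} [IsFiniteMeasure ρ] [IsFiniteMeasure π]
    (h : PlanLE ρ π) (f : Lp ℝ 1 π) : Integrable f ρ :=
  memLp_one_iff_integrable.1 (h.memLp f)

theorem intFun_nonneg {ρ : Measure Z} [IsFiniteMeasure ρ] [IsFiniteMeasure π] (h : PlanLE ρ π)
    (f : Lp ℝ 1 π) (hf : 0 ≤ f) : 0 ≤ intFun h f := by
  rw [intFun_apply]
  exact integral_nonneg_of_ae (h.1.ae_le ((Lp.coeFn_nonneg f).2 hf))

theorem norm_eq_integral_of_nonneg {f : Lp ℝ 1 π} (hf : 0 ≤ f) : ‖f‖ = ∫ z, f z ∂π := by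
  rw [L1.norm_eq_integral_norm]
  refine integral_congr_ae ?_
  filter_upwards [(Lp.coeFn_nonneg f).2 hf] with z hz
  exact Real.norm_of_nonneg hz

/-- A positive functional on `L¹(π)` is integration against a measure of bounded density. -/
theorem exists_measure_of_nonneg [IsFiniteMeasure π] (ℓ : StrongDual ℝ (Lp ℝ 1 π))
    (hℓ : ∀ f : Lp ℝ 1 π, 0 ≤ f → 0 ≤ ℓ f) :
    ∃ (ρ : Measure Z) (_ : IsFiniteMeasure ρ) (h : PlanLE ρ π), ℓ = intFun h := by
  classical
  set m : Set Z → ℝ≥0∞ := fun A => if hA : MeasurableSet A then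
    ENNReal.ofReal (ℓ (indicatorConstLp 1 hA (measure_ne_top π A) (1 : ℝ))) else 0 with hm
  have hmA : ∀ A (hA : MeasurableSet A), m A =
      ENNReal.ofReal (ℓ (indicatorConstLp 1 hA (measure_ne_top π A) (1 : ℝ))) := fun A hA => by
    simp only [hm, dif_pos hA]
  have hnn : ∀ A (hA : MeasurableSet A),
      0 ≤ ℓ (indicatorConstLp 1 hA (measure_ne_top π A) (1 : ℝ)) := fun A hA => by
    refine hℓ _ ((Lp.coeFn_nonneg _).1 ?_)
    filter_upwards [indicatorConstLp_coeFn (p := 1) (hs := hA) (hμs := measure_ne_top π A)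
      (c := (1 : ℝ))] with z hz
    rw [hz]
    exact Set.indicator_nonneg (fun _ _ => zero_le_one) z
  have hfinκ : IsFiniteMeasure (ENNReal.ofReal ‖ℓ‖ • π) :=
    Measure.smul_finite π ENNReal.ofReal_ne_top
  obtain ⟨ρ, hρ, hρm⟩ := exists_measure_of_additive_le (ENNReal.ofReal ‖ℓ‖ • π) m
    (fun A B hA hB hAB => by
      rw [hmA _ hA, hmA _ hB, hmA _ (hA.union hB), ← ENNReal.ofReal_add (hnn A hA) (hnn B hB),
        ← map_add]
      congr 2
      exact indicatorConstLp_disjoint_union hA hB (measure_ne_top π A) (measure_ne_top π B)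
        hAB 1)
    (fun A hA => by
      rw [hmA _ hA, Measure.smul_apply, smul_eq_mul]
      refine (ENNReal.ofReal_le_ofReal ((le_abs_self _).trans (ℓ.le_opNorm _))).trans ?_
      rw [ENNReal.ofReal_mul (norm_nonneg _), norm_indicatorConstLp one_ne_zero ENNReal.one_ne_top]
      simp)
  have hfin : IsFiniteMeasure ρ := isFiniteMeasure_of_le _ hρ
  have hle : PlanLE ρ π := PlanLE.of_le_smul ENNReal.ofReal_ne_top hρ
  refine ⟨ρ, hfin, hle, ?_⟩
  refine ContinuousLinearMap.ext fun f => ?_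
  refine Lp.induction ENNReal.one_ne_top (motive := fun f => ℓ f = intFun hle f) ?_ ?_ ?_ f
  · intro a s hs hμs
    rw [Lp.simpleFunc.coe_indicatorConst]
    have : indicatorConstLp 1 hs hμs.ne a = a • indicatorConstLp 1 hs hμs.ne (1 : ℝ) := by
      refine Lp.ext ?_
      filter_upwards [indicatorConstLp_coeFn (p := 1) (hs := hs) (hμs := hμs.ne) (c := a),
        indicatorConstLp_coeFn (p := 1) (hs := hs) (hμs := hμs.ne) (c := (1 : ℝ)),
        Lp.coeFn_smul a (indicatorConstLp 1 hs hμs.ne (1 : ℝ))] with z h1 h2 h3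
      rw [h1, h3, Pi.smul_apply, h2]
      by_cases hz : z ∈ s <;> simp [hz]
    rw [this, map_smul, map_smul]
    congr 1
    have h1 := hρm s hs
    rw [hmA s hs] at h1
    have h2 : intFun hle (indicatorConstLp 1 hs hμs.ne (1 : ℝ)) = ρ.real s := by
      rw [intFun_apply, integral_congr_ae (hle.1.ae_eq indicatorConstLp_coeFn),
        integral_indicator hs]
      simp
    rw [h2, measureReal_def, h1, ENNReal.toReal_ofReal (hnn s hs)]
  · intro f g hf hg _ h1 h2
    rw [map_add, map_add, h1, h2]
  · exact isClosed_eq ℓ.continuous (intFun hle).continuous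

theorem bidualLE_iff_measure [IsFiniteMeasure π] {g h : Bidual (Lp ℝ 1 π)} :
    BidualLE g h ↔ ∀ (ρ : Measure Z) [IsFiniteMeasure ρ] (hρ : PlanLE ρ π),
      g (intFun hρ) ≤ h (intFun hρ) := by
  refine ⟨fun H ρ _ hρ => H _ (intFun_nonneg hρ), fun H ℓ hℓ => ?_⟩
  obtain ⟨ρ, _, hρ, rfl⟩ := exists_measure_of_nonneg ℓ hℓ
  exact H ρ hρ

theorem integrable_coeFn (f : Lp ℝ 1 π) : Integrable f π :=
  memLp_one_iff_integrable.1 (Lp.memLp f)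

theorem bidualLE_zero_sub {g h : Bidual (Lp ℝ 1 π)} : BidualLE 0 (h - g) ↔ BidualLE g h := by
  simp only [BidualLE, sub_apply, zero_apply, sub_nonneg]

theorem toBidual_add (f g : Lp ℝ 1 π) : toBidual (f + g) = toBidual f + toBidual g := map_add _ f g

theorem toBidual_sub (f g : Lp ℝ 1 π) : toBidual (f - g) = toBidual f - toBidual g :=
  ContinuousLinearMap.ext fun ℓ => map_sub ℓ f g

theorem toBidual_neg (f : Lp ℝ 1 π) : toBidual (-f) = -toBidual f :=
  ContinuousLinearMap.ext fun ℓ => map_neg ℓ f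

theorem toBidual_zero : toBidual (0 : Lp ℝ 1 π) = 0 := map_zero _

theorem pairing_toBidual (f : Lp ℝ 1 π) : pairing (toBidual f) = ∫ z, f z ∂π :=
  integralCLM_apply f

theorem isClosed_setOf_toBidual_le (k : Bidual (Lp ℝ 1 π)) :
    IsClosed {f : Lp ℝ 1 π | BidualLE (toBidual f) k} := by
  simp only [BidualLE, Set.ofPred_forall]
  exact isClosed_iInter fun ℓ => isClosed_iInter fun _ => isClosed_le ℓ.continuous continuous_const

theorem bidualLE_zero_add {a b : Bidual (Lp ℝ 1 π)} (ha : BidualLE 0 a) (hb : BidualLE 0 b) :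
    BidualLE 0 (a + b) := fun ℓ hℓ => add_nonneg (ha ℓ hℓ) (hb ℓ hℓ)

end Functionals

section Decomposition

variable {Z : Type*} [MeasurableSpace Z] {π : Measure Z} [IsFiniteMeasure π]

/-- The value of an element of `L¹(π)**`, seen as a finitely additive measure, on a set. -/
def setVal (k : Bidual (Lp ℝ 1 π)) (A : Set Z) : ℝ :=
  k (intFun (PlanLE.restrict A))

theorem setVal_toBidual (f : Lp ℝ 1 π) (A : Set Z) : setVal (toBidual f) A = ∫ z in A, f z ∂π :=
  intFun_apply _ f

theorem setVal_union (k : Bidual (Lp ℝ 1 π)) {A B : Set Z} (hB : MeasurableSet B)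
    (hAB : Disjoint A B) : setVal k (A ∪ B) = setVal k A + setVal k B := by
  rw [setVal, setVal, setVal, ← map_add]
  congr 1
  refine ContinuousLinearMap.ext fun f => ?_
  rw [add_apply, intFun_apply, intFun_apply, intFun_apply]
  exact setIntegral_union hAB hB (integrable_coeFn f).integrableOn (integrable_coeFn f).integrableOn

theorem setVal_univ (k : Bidual (Lp ℝ 1 π)) : setVal k Set.univ = pairing k := by
  rw [setVal, pairing]
  congr 1
  refine ContinuousLinearMap.ext fun f => ?_
  rw [intFun_apply, integralCLM_apply, Measure.restrict_univ]

theorem setVal_nonneg {k : Bidual (Lp ℝ 1 π)} (hk : BidualLE 0 k) (A : Set Z) : 0 ≤ setVal k A :=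
  hk _ (intFun_nonneg _)

theorem neg_norm_div_two_pow_le (k : Bidual (Lp ℝ 1 π))
    (hk : ∀ A, MeasurableSet A → 0 ≤ setVal k A) (n : ℕ) :
    ∀ (ℓ : StrongDual ℝ (Lp ℝ 1 π)) (g : Z → ℝ), Measurable g → (∀ z, 0 ≤ g z) → (∀ z, g z ≤ 1) →
      (∀ f : Lp ℝ 1 π, ℓ f = ∫ z, g z * f z ∂π) → -(‖k‖ / 2 ^ n) ≤ k ℓ := by
  induction n with
  | zero =>
    intro ℓ g hg h0 h1 hℓ
    have hn : ‖ℓ‖ ≤ 1 := by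
      refine ℓ.opNorm_le_bound zero_le_one fun f => ?_
      rw [hℓ, one_mul, L1.norm_eq_integral_norm]
      refine norm_integral_le_of_norm_le (integrable_coeFn f).norm
        (Eventually.of_forall fun z => ?_)
      rw [norm_mul, Real.norm_of_nonneg (h0 z)]
      exact mul_le_of_le_one_left (norm_nonneg _) (h1 z)
    have h2 := (k.le_opNorm ℓ).trans (mul_le_of_le_one_right (norm_nonneg _) hn)
    rw [pow_zero, div_one]
    exact (abs_le.1 h2).1
  | succ n ih =>
    intro ℓ g hg h0 h1 hℓ
    have hA : MeasurableSet {z | 1 / 2 ≤ g z} := measurableSet_le measurable_const hg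
    have key := ih (2 • ℓ - intFun (PlanLE.restrict {z | 1 / 2 ≤ g z}))
      (fun z => 2 * g z - {z | 1 / 2 ≤ g z}.indicator (fun _ => 1) z)
      ((hg.const_mul 2).sub (measurable_const.indicator hA)) ?_ ?_ ?_
    · have hA' := hk _ hA
      rw [setVal] at hA'
      rw [map_sub, map_nsmul, two_nsmul] at key
      have : ‖k‖ / 2 ^ (n + 1) = ‖k‖ / 2 ^ n / 2 := by rw [pow_succ, div_mul_eq_div_div]
      linarith
    · intro z
      by_cases hz : 1 / 2 ≤ g z
      · simp only [Set.indicator, Set.mem_ofPred_eq, if_pos hz]; linarith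
      · simp only [Set.indicator, Set.mem_ofPred_eq, if_neg hz]; linarith [h0 z]
    · intro z
      by_cases hz : 1 / 2 ≤ g z
      · simp only [Set.indicator, Set.mem_ofPred_eq, if_pos hz]; linarith [h1 z]
      · simp only [Set.indicator, Set.mem_ofPred_eq, if_neg hz]; linarith
    · intro f
      have hi : Integrable (fun z => g z * f z) π :=
        (integrable_coeFn f).bdd_mul (c := 1) hg.aestronglyMeasurable
          (Eventually.of_forall fun z => by rw [Real.norm_of_nonneg (h0 z)]; exact h1 z)
      rw [sub_apply, intFun_apply, two_nsmul, add_apply, hℓ,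
        ← integral_indicator hA, ← two_mul, ← integral_const_mul,
        ← integral_sub (hi.const_mul 2) ((integrable_coeFn f).indicator hA)]
      refine integral_congr_ae (Eventually.of_forall fun z => ?_)
      by_cases hz : 1 / 2 ≤ g z
      · simp only [Set.indicator, Set.mem_ofPred_eq, if_pos hz]; ring
      · simp only [Set.indicator, Set.mem_ofPred_eq, if_neg hz]; ring

/-- The order of `L¹(π)**` is tested on measurable sets. -/
theorem bidualLE_iff_setVal {g h : Bidual (Lp ℝ 1 π)} :
    BidualLE g h ↔ ∀ A, MeasurableSet A → setVal g A ≤ setVal h A := by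
  refine ⟨fun H A _ => H _ (intFun_nonneg _), fun H => bidualLE_iff_measure.2 fun ρ _ hρ => ?_⟩
  set C : ℝ := (essSup (ρ.rnDeriv π) π).toReal + 1 with hC
  have hC0 : 0 < C := by positivity
  have hk : ∀ A, MeasurableSet A → 0 ≤ setVal (h - g) A := fun A hA => by
    have := H A hA
    rw [setVal, sub_apply]
    exact sub_nonneg.2 this
  have hmeas : Measurable fun z => min 1 ((ρ.rnDeriv π z).toReal / C) :=
    measurable_const.min ((Measure.measurable_rnDeriv ρ π).ennreal_toReal.div_const C)
  have hrep : ∀ f : Lp ℝ 1 π, (C⁻¹ • intFun hρ) f =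
      ∫ z, min 1 ((ρ.rnDeriv π z).toReal / C) * f z ∂π := by
    intro f
    rw [smul_apply, intFun_apply, smul_eq_mul,
      ← integral_rnDeriv_smul hρ.1, ← integral_const_mul]
    refine integral_congr_ae ?_
    filter_upwards [ENNReal.ae_le_essSup (μ := π) (ρ.rnDeriv π)] with z hz
    have h1 : (ρ.rnDeriv π z).toReal ≤ C :=
      (ENNReal.toReal_mono hρ.2.ne hz).trans (by rw [hC]; linarith)
    rw [min_eq_right ((div_le_one hC0).2 h1), smul_eq_mul]
    ring
  have hlim : ∀ n : ℕ, -(‖h - g‖ / 2 ^ n) ≤ (h - g) (C⁻¹ • intFun hρ) := fun n =>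
    neg_norm_div_two_pow_le (h - g) hk n _ _ hmeas (fun z => le_min zero_le_one (by positivity))
      (fun z => min_le_left _ _) hrep
  have ht : Tendsto (fun n : ℕ => -(‖h - g‖ / 2 ^ n)) atTop (𝓝 0) := by
    have := (tendsto_pow_atTop_nhds_zero_of_lt_one (r := (1 / 2 : ℝ)) (by norm_num)
      (by norm_num)).const_mul (-‖h - g‖)
    rw [mul_zero] at this
    refine this.congr fun n => ?_
    rw [one_div, inv_pow]; ring
  have h0 := ge_of_tendsto' ht.neg (b := -((h - g) (C⁻¹ • intFun hρ))) fun n => neg_le_neg (hlim n)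
  rw [neg_zero, neg_nonpos, map_smul, smul_eq_mul] at h0
  have := nonneg_of_mul_nonneg_right h0 (inv_pos.2 hC0)
  rw [sub_apply] at this
  exact sub_nonneg.1 this

theorem setVal_add (g h : Bidual (Lp ℝ 1 π)) (A : Set Z) :
    setVal (g + h) A = setVal g A + setVal h A := rfl

theorem setVal_zero (A : Set Z) : setVal (0 : Bidual (Lp ℝ 1 π)) A = 0 := rfl

theorem setVal_mono {k : Bidual (Lp ℝ 1 π)} (hk : BidualLE 0 k) {A B : Set Z}
    (hA : MeasurableSet A) (hB : MeasurableSet B) (h : A ⊆ B) : setVal k A ≤ setVal k B := by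
  have := setVal_union k (hB.diff hA) (Set.disjoint_sdiff_right (s := A) (t := B))
  rw [Set.union_sdiff_cancel h] at this
  linarith [setVal_nonneg hk (B \ A)]

theorem bidualLE_toBidual_sup {f g : Lp ℝ 1 π} {k : Bidual (Lp ℝ 1 π)}
    (hf : BidualLE (toBidual f) k) (hg : BidualLE (toBidual g) k) :
    BidualLE (toBidual (f ⊔ g)) k := by
  rw [bidualLE_iff_setVal] at *
  intro A hA
  set S : Set Z := {z | f z ≤ g z}
  have hS : MeasurableSet S :=
    measurableSet_le (Lp.stronglyMeasurable f).measurable (Lp.stronglyMeasurable g).measurable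
  have e : A = A ∩ S ∪ A \ S := (Set.inter_union_sdiff A S).symm
  have hd : Disjoint (A ∩ S) (A \ S) := Set.disjoint_sdiff_inter.symm
  have hk := setVal_union k (hA.diff hS) hd
  have hs := setVal_union (toBidual (f ⊔ g)) (hA.diff hS) hd
  rw [← e] at hk hs
  rw [hk, hs]
  refine add_le_add (le_trans (le_of_eq ?_) (hg _ (hA.inter hS)))
    (le_trans (le_of_eq ?_) (hf _ (hA.diff hS)))
  · rw [setVal_toBidual, setVal_toBidual]
    refine setIntegral_congr_ae (hA.inter hS) ?_
    filter_upwards [Lp.coeFn_sup f g] with z hz hzS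
    rw [hz, Pi.sup_apply]
    exact sup_eq_right.2 hzS.2
  · rw [setVal_toBidual, setVal_toBidual]
    refine setIntegral_congr_ae (hA.diff hS) ?_
    filter_upwards [Lp.coeFn_sup f g] with z hz hzS
    rw [hz, Pi.sup_apply]
    exact sup_eq_left.2 (le_of_not_ge hzS.2)

theorem pairing_mono {g h : Bidual (Lp ℝ 1 π)} (H : BidualLE g h) : pairing g ≤ pairing h := by
  rw [← setVal_univ, ← setVal_univ]
  exact H _ (intFun_nonneg _)

/-- A positive element of `L¹(π)**` dominates a largest element of `L¹(π)`. -/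
theorem exists_regular_part (k : Bidual (Lp ℝ 1 π)) (hk : BidualLE 0 k) :
    ∃ r : Lp ℝ 1 π, BidualLE (toBidual r) k ∧
      ∀ f : Lp ℝ 1 π, 0 ≤ f → BidualLE (toBidual f) (k - toBidual r) → f = 0 := by
  set S : Set (Lp ℝ 1 π) := {f | BidualLE (toBidual f) k} with hS
  set I : Lp ℝ 1 π → ℝ := fun f => pairing (toBidual f) with hI
  have hIsub : ∀ f g, I (f - g) = I f - I g := fun f g => by
    simp only [hI, toBidual_sub]; rfl
  have hImono : ∀ f g, f ≤ g → ‖g - f‖ = I g - I f := fun f g h => by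
    rw [norm_eq_integral_of_nonneg (sub_nonneg.2 h), ← pairing_toBidual, ← hIsub]
  have hbdd : BddAbove (I '' S) := ⟨pairing k, by
    rintro _ ⟨f, hf, rfl⟩
    exact pairing_mono hf⟩
  have hne : (I '' S).Nonempty := ⟨I 0, 0, by
    change BidualLE (toBidual 0) k
    rwa [toBidual_zero], rfl⟩
  have hseq : ∀ n : ℕ, ∃ f ∈ S, sSup (I '' S) - 1 / ((n : ℝ) + 1) < I f := fun n => by
    obtain ⟨_, ⟨f, hf, rfl⟩, h⟩ := exists_lt_of_lt_csSup hne
      (sub_lt_self (sSup (I '' S)) (Nat.one_div_pos_of_nat (n := n) (α := ℝ)))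
    exact ⟨f, hf, h⟩
  choose f hfS hfI using hseq
  have hmonoI : ∀ f g, f ≤ g → I f ≤ I g := fun f g h => by
    linarith [hImono f g h, norm_nonneg (g - f)]
  have hFS : ∀ n, partialSups f n ∈ S := fun n => by
    induction n with
    | zero => simpa using hfS 0
    | succ n ih =>
      rw [partialSups_add_one]
      exact bidualLE_toBidual_sup ih (hfS _)
  have hFle : ∀ n, I (partialSups f n) ≤ sSup (I '' S) := fun n =>
    le_csSup hbdd ⟨_, hFS n, rfl⟩
  have hFge : ∀ n : ℕ, sSup (I '' S) - 1 / ((n : ℝ) + 1) ≤ I (partialSups f n) := fun n =>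
    (hfI n).le.trans (hmonoI _ _ (le_partialSups f n))
  have hdist : ∀ N n, N ≤ n → dist (partialSups f n) (partialSups f N) ≤ 1 / ((N : ℝ) + 1) :=
    fun N n h => by
      rw [dist_eq_norm, hImono _ _ ((partialSups f).monotone h)]
      linarith [hFle n, hFge N]
  have hcauchy : CauchySeq fun n => partialSups f n := by
    refine cauchySeq_of_le_tendsto_0 (fun N : ℕ => 2 * (1 / ((N : ℝ) + 1)))
      (fun n m N hn hm => ?_) ?_
    · linarith [dist_triangle_right (partialSups f n) (partialSups f m) (partialSups f N),
        hdist N n hn, hdist N m hm]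
    · simpa using tendsto_one_div_add_atTop_nhds_zero_nat.const_mul (2 : ℝ)
  obtain ⟨r, hr⟩ := cauchySeq_tendsto_of_complete hcauchy
  have hrS : r ∈ S := (isClosed_setOf_toBidual_le k).mem_of_tendsto hr (Eventually.of_forall hFS)
  have hIc : Continuous I := (L1.integralCLM : StrongDual ℝ (Lp ℝ 1 π)).continuous
  have hIr : sSup (I '' S) ≤ I r := by
    have h1 : Tendsto (fun n : ℕ => sSup (I '' S) - 1 / ((n : ℝ) + 1)) atTop
        (𝓝 (sSup (I '' S) - 0)) :=
      tendsto_const_nhds.sub tendsto_one_div_add_atTop_nhds_zero_nat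
    rw [sub_zero] at h1
    exact le_of_tendsto_of_tendsto' h1 ((hIc.tendsto r).comp hr) hFge
  refine ⟨r, hrS, fun g hg hgk => ?_⟩
  have hgr : g + r ∈ S := by
    have := bidualLE_zero_sub.2 hgk
    refine bidualLE_zero_sub.1 ?_
    rw [toBidual_add]
    convert this using 1
    abel
  have h1 : I (g + r) ≤ I r := (le_csSup hbdd ⟨_, hgr, rfl⟩).trans hIr
  have h2 := hImono r (g + r) (le_add_of_nonneg_left hg)
  rw [add_sub_cancel_right] at h2
  exact norm_le_zero_iff.1 (by linarith)

/-- Positive elements of `L¹(π)**` with no regular part are stable under addition. -/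
theorem eq_zero_of_le_add {a b : Bidual (Lp ℝ 1 π)} (ha : BidualLE 0 a) (hb : BidualLE 0 b)
    (ha' : ∀ f : Lp ℝ 1 π, 0 ≤ f → BidualLE (toBidual f) a → f = 0)
    (hb' : ∀ f : Lp ℝ 1 π, 0 ≤ f → BidualLE (toBidual f) b → f = 0)
    (f : Lp ℝ 1 π) (hf : 0 ≤ f) (hfab : BidualLE (toBidual f) (a + b)) : f = 0 := by
  have hf0 : BidualLE 0 (toBidual f) := fun ℓ hℓ => hℓ f hf
  set t : Set Z → Set Z → ℝ≥0∞ := fun A B =>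
    ENNReal.ofReal (setVal a (A ∩ B)) + ENNReal.ofReal (setVal (toBidual f) (A \ B)) with ht
  set m : Set Z → ℝ≥0∞ := fun A => ⨅ B : {B : Set Z // MeasurableSet B}, t A B.1 with hm
  set κ : Measure Z := π.withDensity (fun z => ENNReal.ofReal (f z)) with hκ
  have hκfin : IsFiniteMeasure κ := isFiniteMeasure_withDensity_ofReal (integrable_coeFn f).2
  have hofReal : ∀ (k : Bidual (Lp ℝ 1 π)), BidualLE 0 k → ∀ A B : Set Z, MeasurableSet B →
      Disjoint A B → ENNReal.ofReal (setVal k (A ∪ B)) =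
        ENNReal.ofReal (setVal k A) + ENNReal.ofReal (setVal k B) := fun k hk A B hB hAB => by
    rw [setVal_union k hB hAB, ENNReal.ofReal_add (setVal_nonneg hk A) (setVal_nonneg hk B)]
  have htadd : ∀ A₁ A₂ B : Set Z, MeasurableSet A₂ → MeasurableSet B → Disjoint A₁ A₂ →
      t (A₁ ∪ A₂) B = t A₁ B + t A₂ B := fun A₁ A₂ B hA₂ hB hd => by
    simp only [ht]
    rw [Set.union_inter_distrib_right, Set.union_sdiff_distrib,
      hofReal a ha _ _ (hA₂.inter hB) (hd.mono Set.inter_subset_left Set.inter_subset_left),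
      hofReal _ hf0 _ _ (hA₂.diff hB) (hd.mono Set.sdiff_subset Set.sdiff_subset)]
    ring
  have hadd : ∀ A₁ A₂, MeasurableSet A₁ → MeasurableSet A₂ → Disjoint A₁ A₂ →
      m (A₁ ∪ A₂) = m A₁ + m A₂ := by
    intro A₁ A₂ hA₁ hA₂ hd
    refine le_antisymm ?_ (le_iInf fun B => ?_)
    · simp only [hm]
      refine ENNReal.le_iInf_add_iInf fun B₁ B₂ => ?_
      refine (iInf_le _ ⟨A₁ ∩ B₁.1 ∪ A₂ ∩ B₂.1, (hA₁.inter B₁.2).union (hA₂.inter B₂.2)⟩).trans ?_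
      rw [htadd _ _ _ hA₂ ((hA₁.inter B₁.2).union (hA₂.inter B₂.2)) hd]
      have hd' := Set.disjoint_left.1 hd
      have e1 : A₁ ∩ (A₁ ∩ B₁.1 ∪ A₂ ∩ B₂.1) = A₁ ∩ B₁.1 := by grind
      have e2 : A₁ \ (A₁ ∩ B₁.1 ∪ A₂ ∩ B₂.1) = A₁ \ B₁.1 := by grind
      have e3 : A₂ ∩ (A₁ ∩ B₁.1 ∪ A₂ ∩ B₂.1) = A₂ ∩ B₂.1 := by grind
      have e4 : A₂ \ (A₁ ∩ B₁.1 ∪ A₂ ∩ B₂.1) = A₂ \ B₂.1 := by grind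
      simp only [ht, e1, e2, e3, e4]
      exact le_rfl
    · rw [htadd _ _ _ hA₂ B.2 hd]
      exact add_le_add (iInf_le _ B) (iInf_le _ B)
  have hle : ∀ A, MeasurableSet A → m A ≤ κ A := by
    intro A hA
    refine (iInf_le _ ⟨∅, MeasurableSet.empty⟩).trans (le_of_eq ?_)
    have h0 : setVal a ∅ = 0 := by
      have := setVal_union a MeasurableSet.empty (Set.disjoint_empty (∅ : Set Z))
      simp only [Set.union_empty] at this
      linarith
    simp only [ht, Set.inter_empty, Set.sdiff_empty, h0, ENNReal.ofReal_zero, zero_add]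
    rw [setVal_toBidual, hκ, withDensity_apply _ hA,
      ofReal_integral_eq_lintegral_ofReal (integrable_coeFn f).integrableOn
        (ae_restrict_of_ae ((Lp.coeFn_nonneg f).2 hf))]
  obtain ⟨ρ, hρκ, hρ⟩ := exists_measure_of_additive_le κ m hadd hle
  have hρfin : IsFiniteMeasure ρ := isFiniteMeasure_of_le _ hρκ
  have hρπ : ρ ≪ π := (Measure.absolutelyContinuous_of_le hρκ).trans
    (withDensity_absolutelyContinuous _ _)
  set d : Lp ℝ 1 π := Integrable.toL1 (fun z => (ρ.rnDeriv π z).toReal)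
    Measure.integrable_toReal_rnDeriv with hd
  have hdval : ∀ A, setVal (toBidual d) A = ρ.real A := fun A => by
    rw [setVal_toBidual, ← Measure.setIntegral_toReal_rnDeriv hρπ]
    exact integral_congr_ae (ae_restrict_of_ae (Integrable.coeFn_toL1 _))
  have hd0 : d = 0 := by
    refine ha' d ?_ (bidualLE_iff_setVal.2 fun A hA => ?_)
    · refine (Lp.coeFn_nonneg d).1 ?_
      filter_upwards [Integrable.coeFn_toL1 (Measure.integrable_toReal_rnDeriv (μ := ρ) (ν := π))]
        with z hz
      rw [hd, hz]
      exact ENNReal.toReal_nonneg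
    · rw [hdval, measureReal_def, hρ A hA]
      refine ENNReal.toReal_le_of_le_ofReal (setVal_nonneg ha A) ?_
      refine (iInf_le _ ⟨Set.univ, MeasurableSet.univ⟩).trans (le_of_eq ?_)
      have h0 : setVal (toBidual f) ∅ = 0 := by simp [setVal_toBidual]
      simp only [ht, Set.inter_univ, Set.sdiff_univ, h0, ENNReal.ofReal_zero, add_zero]
  have hm0 : ∀ A, MeasurableSet A → m A = 0 := fun A hA => by
    have := hdval A
    rw [hd0, toBidual_zero, setVal_zero, measureReal_def, eq_comm,
      ENNReal.toReal_eq_zero_iff, or_iff_left (measure_ne_top ρ A), hρ A hA] at this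
    exact this
  refine hb' f hf (bidualLE_iff_setVal.2 fun A hA => ?_)
  have key : ENNReal.ofReal (setVal (toBidual f) A) ≤ m A + ENNReal.ofReal (setVal b A) := by
    simp only [hm]
    rw [ENNReal.iInf_add]
    refine le_iInf fun B => ?_
    have h1 := hofReal _ hf0 (A ∩ B.1) (A \ B.1) (hA.diff B.2) Set.disjoint_sdiff_inter.symm
    rw [Set.inter_union_sdiff] at h1
    rw [h1]
    have h2 : setVal (toBidual f) (A ∩ B.1) ≤ setVal a (A ∩ B.1) + setVal b A :=
      (bidualLE_iff_setVal.1 hfab _ (hA.inter B.2)).trans (by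
        rw [setVal_add]
        linarith [setVal_mono hb (hA.inter B.2) hA Set.inter_subset_left])
    have h3 := ENNReal.ofReal_le_ofReal h2
    rw [ENNReal.ofReal_add (setVal_nonneg ha _) (setVal_nonneg hb _)] at h3
    simp only [ht]
    calc _ ≤ ENNReal.ofReal (setVal a (A ∩ B.1)) + ENNReal.ofReal (setVal b A) +
        ENNReal.ofReal (setVal (toBidual f) (A \ B.1)) := by gcongr
      _ = _ := by ring
  rw [hm0 A hA, zero_add] at key
  exact (ENNReal.ofReal_le_ofReal_iff (setVal_nonneg hb A)).1 key

theorem eq_zero_of_toBidual_eq_sub {r : Lp ℝ 1 π} {a b : Bidual (Lp ℝ 1 π)}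
    (h : toBidual r = a - b) (ha : BidualLE 0 a) (hb : BidualLE 0 b)
    (ha' : ∀ f : Lp ℝ 1 π, 0 ≤ f → BidualLE (toBidual f) a → f = 0)
    (hb' : ∀ f : Lp ℝ 1 π, 0 ≤ f → BidualLE (toBidual f) b → f = 0) : r = 0 := by
  refine le_antisymm ?_ ?_
  · rw [← sup_eq_right]
    refine ha' _ le_sup_right (bidualLE_toBidual_sup ?_ (by rwa [toBidual_zero]))
    refine bidualLE_zero_sub.1 ?_
    rw [h]
    exact fun ℓ hℓ => (hb ℓ hℓ).trans_eq (sub_sub_cancel (a ℓ) (b ℓ)).symm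
  · rw [← neg_nonpos, ← sup_eq_right]
    refine hb' _ le_sup_right (bidualLE_toBidual_sup ?_ (by rwa [toBidual_zero]))
    refine bidualLE_zero_sub.1 ?_
    rw [toBidual_neg, h]
    exact fun ℓ hℓ => (ha ℓ hℓ).trans_eq (by
      change a ℓ = b ℓ - -(a ℓ - b ℓ)
      ring)

theorem IsRegularSingular.unique {h : Bidual (Lp ℝ 1 π)} {r r' : Lp ℝ 1 π}
    {s s' : Bidual (Lp ℝ 1 π)} (H : IsRegularSingular h r s) (H' : IsRegularSingular h r' s') :
    r = r' ∧ s = s' := by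
  obtain ⟨e, g₁, g₂, rfl, p₁, p₂, q₁, q₂⟩ := H
  obtain ⟨e', g₁', g₂', rfl, p₁', p₂', q₁', q₂'⟩ := H'
  have hr : r - r' = 0 := by
    refine eq_zero_of_toBidual_eq_sub (a := g₁' + g₂) (b := g₂' + g₁) ?_ (bidualLE_zero_add p₁' p₂)
      (bidualLE_zero_add p₂' p₁) (eq_zero_of_le_add p₁' p₂ q₁' q₂) (eq_zero_of_le_add p₂' p₁ q₂' q₁)
    rw [toBidual_sub]
    have := e.symm.trans e'
    rw [← sub_eq_zero] at this ⊢
    rw [← this]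
    abel
  have hr' := sub_eq_zero.1 hr
  subst hr'
  exact ⟨rfl, ContinuousLinearMap.ext fun ℓ =>
    add_left_cancel (DFunLike.congr_fun (e.symm.trans e') ℓ)⟩

/-- An element of `L¹(π)**` dominated by `c ∈ L¹(π)` has a unique decomposition into a regular and
a purely singular part, and the order relation splits accordingly. -/
theorem regularSingular_of_le {h : Bidual (Lp ℝ 1 π)} {c : Lp ℝ 1 π}
    (hc : BidualLE h (toBidual c)) :
    (∃! p : Lp ℝ 1 π × Bidual (Lp ℝ 1 π), IsRegularSingular h p.1 p.2) ∧
      ∀ (r : Lp ℝ 1 π) (s : Bidual (Lp ℝ 1 π)), IsRegularSingular h r s →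
        r ≤ c ∧ BidualLE s 0 := by
  obtain ⟨q, hq, hmax⟩ := exists_regular_part (toBidual c - h) (bidualLE_zero_sub.2 hc)
  have hs : BidualLE 0 (toBidual c - h - toBidual q) := bidualLE_zero_sub.2 hq
  have hq0 : 0 ≤ q := by
    have h1 := hmax (q ⊔ 0 - q) (sub_nonneg.2 le_sup_left) (bidualLE_zero_sub.1 ?_)
    · rw [sub_eq_zero] at h1
      rw [← h1]
      exact le_sup_right
    · have h2 := bidualLE_toBidual_sup hq (by
        rw [toBidual_zero]; exact bidualLE_zero_sub.2 hc : BidualLE (toBidual 0) _)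
      have h3 := bidualLE_zero_sub.2 h2
      rw [toBidual_sub]
      exact fun ℓ hℓ => (h3 ℓ hℓ).trans_eq (sub_sub_sub_cancel_right _ _ _).symm
  have hdec : IsRegularSingular h (c - q) (-(toBidual c - h - toBidual q)) := by
    refine ⟨by rw [toBidual_sub]; abel, 0, toBidual c - h - toBidual q, 
      ContinuousLinearMap.ext fun ℓ => (zero_sub _).symm,
      fun _ _ => le_rfl, hs, fun f hf hf0 => ?_, hmax⟩
    have h1 := pairing_mono hf0
    rw [pairing_toBidual, ← norm_eq_integral_of_nonneg hf] at h1
    exact norm_le_zero_iff.1 h1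
  refine ⟨⟨(c - q, _), hdec, fun p hp => Prod.ext (hp.unique hdec).1 (hp.unique hdec).2⟩,
    fun r s hrs => ?_⟩
  obtain ⟨rfl, rfl⟩ := hrs.unique hdec
  refine ⟨sub_le_self _ hq0, fun ℓ hℓ => ?_⟩
  have := hs ℓ hℓ
  rw [neg_apply]
  exact neg_nonpos.2 this

end Decomposition

section Family

variable {X Y : Type*} [MeasurableSpace X] [MeasurableSpace Y] {μ : Measure X} {ν : Measure Y}

theorem integrable_fst {π : Measure (X × Y)} (hπ : π ∈ plans μ ν) {φ : X → ℝ}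
    (hφ : Integrable φ μ) : Integrable (fun z : X × Y => φ z.1) π :=
  Integrable.comp_measurable (f := Prod.fst) (hπ.1.symm ▸ hφ : Integrable φ π.fst) measurable_fst

theorem integrable_snd {π : Measure (X × Y)} (hπ : π ∈ plans μ ν) {ψ : Y → ℝ}
    (hψ : Integrable ψ ν) : Integrable (fun z : X × Y => ψ z.2) π :=
  Integrable.comp_measurable (f := Prod.snd) (hπ.2.symm ▸ hψ : Integrable ψ π.snd) measurable_snd

theorem integral_oplus {π : Measure (X × Y)} (hπ : π ∈ plans μ ν) {φ : X → ℝ} {ψ : Y → ℝ}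
    (hφ : Integrable φ μ) (hψ : Integrable ψ ν) :
    ∫ z, (φ z.1 + ψ z.2) ∂π = ∫ x, φ x ∂μ + ∫ y, ψ y ∂ν := by
  have h1 : ∫ z : X × Y, φ z.1 ∂π = ∫ x, φ x ∂μ := by
    rw [← hπ.1]
    exact (integral_map measurable_fst.aemeasurable
      (hπ.1.symm ▸ hφ : Integrable φ π.fst).aestronglyMeasurable).symm
  have h2 : ∫ z : X × Y, ψ z.2 ∂π = ∫ y, ψ y ∂ν := by
    rw [← hπ.2]
    exact (integral_map measurable_snd.aemeasurable
      (hπ.2.symm ▸ hψ : Integrable ψ π.snd).aestronglyMeasurable).symm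
  rw [integral_add (integrable_fst hπ hφ) (integrable_snd hπ hψ), h1, h2]

theorem isProbabilityMeasure_of_mem_plans [IsProbabilityMeasure μ] {π : Measure (X × Y)}
    (hπ : π ∈ plans μ ν) : IsProbabilityMeasure π :=
  ⟨by rw [← Measure.fst_univ, hπ.1]; exact measure_univ⟩

/-- A positive functional which acts on the functions `φ ⊕ ψ` as `t` times a transport plan has
value at least `t * p` at the cost, if all plans of bounded density cost at least `p`. -/
theorem mul_le_apply_costL1 [IsProbabilityMeasure μ] [IsProbabilityMeasure ν] {c : X × Y → ℝ≥0∞}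
    (hc : Measurable c) {π : Measure (X × Y)} (hπ : π ∈ finitePlans μ ν c) [IsFiniteMeasure π]
    {p : ℝ} (hp : ∀ π' ∈ plans μ ν, PlanLE π' π → ENNReal.ofReal p ≤ ∫⁻ z, c z ∂π')
    (ℓ : StrongDual ℝ (Lp ℝ 1 π)) (hℓ : ∀ f : Lp ℝ 1 π, 0 ≤ f → 0 ≤ ℓ f) (t : ℝ)
    (ht : ∀ (φ : X → ℝ) (ψ : Y → ℝ) (f : Lp ℝ 1 π), Integrable φ μ → Integrable ψ ν →
      f =ᵐ[π] (fun z => φ z.1 + ψ z.2) → ℓ f = t * (∫ x, φ x ∂μ + ∫ y, ψ y ∂ν)) :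
    t * p ≤ ℓ (costL1 c hc hπ.2) := by
  obtain ⟨ρ, _, hρ, rfl⟩ := exists_measure_of_nonneg ℓ hℓ
  have hint : ∀ (φ : X → ℝ) (ψ : Y → ℝ), Integrable φ μ → Integrable ψ ν →
      ∫ z, (φ z.1 + ψ z.2) ∂ρ = t * (∫ x, φ x ∂μ + ∫ y, ψ y ∂ν) := fun φ ψ hφ hψ => by
    have hi := (integrable_fst hπ.1 hφ).add (integrable_snd hπ.1 hψ)
    rw [← ht φ ψ (hi.toL1 _) hφ hψ (Integrable.coeFn_toL1 hi), intFun_apply]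
    exact integral_congr_ae (hρ.1.ae_eq (Integrable.coeFn_toL1 hi).symm)
  have ht0 : 0 ≤ t := by
    have := hint (fun _ => 1) (fun _ => 0) (integrable_const _) (integrable_const _)
    simp only [integral_const, add_zero, smul_eq_mul, mul_one, probReal_univ, mul_zero] at this
    rw [← this]
    exact measureReal_nonneg
  have hcae : costL1 c hc hπ.2 =ᵐ[ρ] fun z => (c z).toReal :=
    hρ.1.ae_eq (Integrable.coeFn_toL1 _)
  have hcρ : ∫⁻ z, c z ∂ρ = ENNReal.ofReal (intFun hρ (costL1 c hc hπ.2)) := by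
    have hi : Integrable (fun z => (c z).toReal) ρ := (hρ.integrable _).congr hcae
    rw [intFun_apply, integral_congr_ae hcae, ofReal_integral_eq_lintegral_ofReal hi
      (Eventually.of_forall fun z => ENNReal.toReal_nonneg)]
    refine lintegral_congr_ae ?_
    filter_upwards [hρ.1.ae_le (ae_lt_top hc hπ.2)] with z hz
    exact (ENNReal.ofReal_toReal hz.ne).symm
  have hc0 : 0 ≤ intFun hρ (costL1 c hc hπ.2) := by
    rw [intFun_apply, integral_congr_ae hcae]
    exact integral_nonneg fun z => ENNReal.toReal_nonneg
  rcases ht0.eq_or_lt with rfl | htpos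
  · rwa [zero_mul]
  have hfst : ∀ A, MeasurableSet A → ρ (Prod.fst ⁻¹' A) = ENNReal.ofReal t * μ A := fun A hA => by
    have := hint (A.indicator fun _ => 1) (fun _ => 0) ((integrable_const _).indicator hA)
      (integrable_const _)
    simp only [add_zero, integral_zero, integral_indicator hA] at this
    have h2 : ∫ z : X × Y, A.indicator (fun _ => (1 : ℝ)) z.1 ∂ρ = ρ.real (Prod.fst ⁻¹' A) := by
      rw [← integral_indicator_one (measurable_fst hA)]
      rfl
    rw [h2] at this
    simp only [integral_const, smul_eq_mul, mul_one, measureReal_restrict_apply_univ] at this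
    rw [← ENNReal.ofReal_toReal (measure_ne_top ρ _), ← measureReal_def, this,
      ENNReal.ofReal_mul ht0, measureReal_def, ENNReal.ofReal_toReal (measure_ne_top μ _)]
  have hsnd : ∀ A, MeasurableSet A → ρ (Prod.snd ⁻¹' A) = ENNReal.ofReal t * ν A := fun A hA => by
    have := hint (fun _ => 0) (A.indicator fun _ => 1) (integrable_const _)
      ((integrable_const _).indicator hA)
    simp only [zero_add, integral_zero, integral_indicator hA] at this
    have h2 : ∫ z : X × Y, A.indicator (fun _ => (1 : ℝ)) z.2 ∂ρ = ρ.real (Prod.snd ⁻¹' A) := by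
      rw [← integral_indicator_one (measurable_snd hA)]
      rfl
    rw [h2] at this
    simp only [integral_const, smul_eq_mul, mul_one, measureReal_restrict_apply_univ] at this
    rw [← ENNReal.ofReal_toReal (measure_ne_top ρ _), ← measureReal_def, this,
      ENNReal.ofReal_mul ht0, measureReal_def, ENNReal.ofReal_toReal (measure_ne_top ν _)]
  have htinv : ENNReal.ofReal t⁻¹ * ENNReal.ofReal t = 1 := by
    rw [← ENNReal.ofReal_mul (inv_nonneg.2 ht0), inv_mul_cancel₀ htpos.ne', ENNReal.ofReal_one]
  have hfin : IsFiniteMeasure (ENNReal.ofReal t⁻¹ • ρ) :=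
    Measure.smul_finite ρ ENNReal.ofReal_ne_top
  have hplan : ENNReal.ofReal t⁻¹ • ρ ∈ plans μ ν := by
    constructor
    · ext A hA
      rw [Measure.fst_apply hA, Measure.smul_apply, hfst A hA, smul_eq_mul, ← mul_assoc, htinv,
        one_mul]
    · ext A hA
      rw [Measure.snd_apply hA, Measure.smul_apply, hsnd A hA, smul_eq_mul, ← mul_assoc, htinv,
        one_mul]
  have hle : PlanLE (ENNReal.ofReal t⁻¹ • ρ) π :=
    (PlanLE.of_le_smul ENNReal.ofReal_ne_top le_rfl).trans hρ
  have key := hp _ hplan hle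
  rw [lintegral_smul_measure, hcρ, smul_eq_mul, ← ENNReal.ofReal_mul (inv_nonneg.2 ht0),
    ENNReal.ofReal_le_ofReal_iff (mul_nonneg (inv_nonneg.2 ht0) hc0)] at key
  rwa [inv_mul_eq_div, le_div_iff₀ htpos, mul_comm] at key

variable {c : X × Y → ℝ≥0∞} {π₀ : Measure (X × Y)}

variable (μ ν c π₀) in
/-- The functions which are integrable for all plans of the index set. -/
def commonIntegrable : Submodule ℝ (X × Y → ℝ) where
  carrier := {f | ∀ π : PlansAbove μ ν c π₀, Integrable f π.1}
  add_mem' hf hg π := (hf π).add (hg π)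
  zero_mem' _ := integrable_zero _ _ _
  smul_mem' a _ hf π := (hf π).smul a

/-- The functional on the common integrable functions induced by a functional on `L¹(π)`. -/
def restrictDual (π : PlansAbove μ ν c π₀) :
    StrongDual ℝ (Lp ℝ 1 π.1) →ₗ[ℝ] commonIntegrable μ ν c π₀ →ₗ[ℝ] ℝ where
  toFun ℓ :=
    { toFun := fun f => ℓ ((f.2 π).toL1 f.1)
      map_add' := fun f g => by rw [← map_add]; rfl
      map_smul' := fun a f => by rw [RingHom.id_apply, ← map_smul]; rfl }
  map_add' _ _ := rfl
  map_smul' _ _ := rfl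

theorem restrictDual_apply (π : PlansAbove μ ν c π₀) (ℓ : StrongDual ℝ (Lp ℝ 1 π.1))
    (f : commonIntegrable μ ν c π₀) : restrictDual π ℓ f = ℓ ((f.2 π).toL1 f.1) := rfl

theorem oplus_mem_commonIntegrable {φ : X → ℝ} {ψ : Y → ℝ} (hφ : Integrable φ μ)
    (hψ : Integrable ψ ν) : (fun z : X × Y => φ z.1 + ψ z.2) ∈ commonIntegrable μ ν c π₀ :=
  fun π => (integrable_fst π.2.1.1 hφ).add (integrable_snd π.2.1.1 hψ)

theorem cost_mem_commonIntegrable (hc : Measurable c) :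
    (fun z => (c z).toReal) ∈ commonIntegrable μ ν c π₀ :=
  fun π => integrable_toReal_of_lintegral_ne_top hc.aemeasurable π.2.1.2

theorem norm_smul_integral_add_nonneg {Z : Type*} [MeasurableSpace Z] {π : Measure Z}
    (ℓ : StrongDual ℝ (Lp ℝ 1 π)) (f : Lp ℝ 1 π) (hf : 0 ≤ f) :
    0 ≤ (‖ℓ‖ • (L1.integralCLM : StrongDual ℝ (Lp ℝ 1 π)) + ℓ) f := by
  change 0 ≤ ‖ℓ‖ * (L1.integralCLM : StrongDual ℝ (Lp ℝ 1 π)) f + ℓ f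
  rw [integralCLM_apply, ← norm_eq_integral_of_nonneg hf]
  linarith [(abs_le.1 (ℓ.le_opNorm f)).1]

variable [IsProbabilityMeasure μ]

theorem exists_planLE_upper (π₁ π₂ : PlansAbove μ ν c π₀) [IsFiniteMeasure π₀] :
    ∃ π₃ : PlansAbove μ ν c π₀, PlanLE π₁.1 π₃.1 ∧ PlanLE π₂.1 π₃.1 := by
  have h2 : (2 : ℝ≥0∞)⁻¹ ≠ ∞ := by simp
  set m : Measure (X × Y) := (2 : ℝ≥0∞)⁻¹ • π₁.1 + (2 : ℝ≥0∞)⁻¹ • π₂.1 with hm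
  have hmp : m ∈ plans μ ν := by
    constructor
    · rw [Measure.fst, hm, Measure.map_add _ _ measurable_fst, Measure.map_smul, Measure.map_smul]
      have e1 : π₁.1.map Prod.fst = μ := π₁.2.1.1.1
      have e2 : π₂.1.map Prod.fst = μ := π₂.2.1.1.1
      rw [e1, e2, ← add_smul, ENNReal.inv_two_add_inv_two, one_smul]
    · rw [Measure.snd, hm, Measure.map_add _ _ measurable_snd, Measure.map_smul, Measure.map_smul]
      have e1 : π₁.1.map Prod.snd = ν := π₁.2.1.1.2
      have e2 : π₂.1.map Prod.snd = ν := π₂.2.1.1.2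
      rw [e1, e2, ← add_smul, ENNReal.inv_two_add_inv_two, one_smul]
  have hprob := isProbabilityMeasure_of_mem_plans hmp
  have htwo : ∀ m' : Measure (X × Y), (2 : ℝ≥0∞) • (2 : ℝ≥0∞)⁻¹ • m' = m' := fun m' => by
    rw [← mul_smul, ENNReal.mul_inv_cancel two_ne_zero ENNReal.ofNat_ne_top, one_smul]
  have h₁ : PlanLE π₁.1 m := PlanLE.of_le_smul (C := 2) ENNReal.ofNat_ne_top (by
    rw [hm, smul_add, htwo, htwo]
    exact Measure.le_add_right le_rfl)
  have h₂ : PlanLE π₂.1 m := PlanLE.of_le_smul (C := 2) ENNReal.ofNat_ne_top (by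
    rw [hm, smul_add, htwo, htwo]
    exact Measure.le_add_left le_rfl)
  refine ⟨⟨m, ⟨hmp, ?_⟩, π₁.2.2.trans h₁⟩, h₁, h₂⟩
  rw [hm, lintegral_add_measure, lintegral_smul_measure, lintegral_smul_measure]
  exact ENNReal.add_ne_top.2 ⟨ENNReal.mul_ne_top h2 π₁.2.1.2, ENNReal.mul_ne_top h2 π₂.2.1.2⟩

theorem restrictDual_comp_proj {π₁ π₂ : PlansAbove μ ν c π₀} (h : PlanLE π₁.1 π₂.1)
    (ℓ : StrongDual ℝ (Lp ℝ 1 π₁.1)) :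
    restrictDual π₂ (ℓ.comp (proj h)) = restrictDual π₁ ℓ := by
  refine LinearMap.ext fun f => ?_
  rw [restrictDual_apply, restrictDual_apply, ContinuousLinearMap.comp_apply]
  congr 1
  refine Lp.ext ?_
  exact (proj_ae_eq h _).trans ((h.1.ae_eq (Integrable.coeFn_toL1 (f.2 π₂))).trans
    (Integrable.coeFn_toL1 (f.2 π₁)).symm)

theorem comp_proj_nonneg {π₁ π₂ : PlansAbove μ ν c π₀} (h : PlanLE π₁.1 π₂.1)
    {ℓ : StrongDual ℝ (Lp ℝ 1 π₁.1)} (hℓ : ∀ f : Lp ℝ 1 π₁.1, 0 ≤ f → 0 ≤ ℓ f)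
    (f : Lp ℝ 1 π₂.1) (hf : 0 ≤ f) : 0 ≤ ℓ.comp (proj h) f := by
  refine hℓ _ ((Lp.coeFn_nonneg _).1 ?_)
  filter_upwards [proj_ae_eq h f, h.1.ae_le ((Lp.coeFn_nonneg f).2 hf)] with z h1 h2
  exact h2.trans_eq h1.symm

/-- The union over the index set of the duals of the spaces `L¹(π)`. -/
def dualUnion (hπ₀ : π₀ ∈ finitePlans μ ν c) :
    Submodule ℝ (commonIntegrable μ ν c π₀ →ₗ[ℝ] ℝ) where
  carrier := {m | ∃ (π : PlansAbove μ ν c π₀) (ℓ : StrongDual ℝ (Lp ℝ 1 π.1)),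
    restrictDual π ℓ = m}
  add_mem' := by
    rintro _ _ ⟨π₁, ℓ₁, rfl⟩ ⟨π₂, ℓ₂, rfl⟩
    have := isProbabilityMeasure_of_mem_plans hπ₀.1
    obtain ⟨π₃, h₁, h₂⟩ := exists_planLE_upper π₁ π₂
    exact ⟨π₃, ℓ₁.comp (proj h₁) + ℓ₂.comp (proj h₂), by
      rw [map_add, restrictDual_comp_proj, restrictDual_comp_proj]⟩
  zero_mem' := by
    have := isProbabilityMeasure_of_mem_plans hπ₀.1
    exact ⟨⟨π₀, hπ₀, PlanLE.refl⟩, 0, map_zero _⟩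
  smul_mem' := by
    rintro a _ ⟨π, ℓ, rfl⟩
    exact ⟨π, a • ℓ, map_smul _ _ _⟩

/-- The positive cone of `dualUnion`. -/
def dualUnionCone (hπ₀ : π₀ ∈ finitePlans μ ν c) : PointedCone ℝ (dualUnion hπ₀) where
  carrier := {m | ∃ (π : PlansAbove μ ν c π₀) (ℓ : StrongDual ℝ (Lp ℝ 1 π.1)),
    (∀ f : Lp ℝ 1 π.1, 0 ≤ f → 0 ≤ ℓ f) ∧ restrictDual π ℓ = m.1}
  add_mem' := by
    rintro ⟨_, _⟩ ⟨_, _⟩ ⟨π₁, ℓ₁, hp₁, rfl⟩ ⟨π₂, ℓ₂, hp₂, rfl⟩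
    have := isProbabilityMeasure_of_mem_plans hπ₀.1
    obtain ⟨π₃, h₁, h₂⟩ := exists_planLE_upper π₁ π₂
    exact ⟨π₃, ℓ₁.comp (proj h₁) + ℓ₂.comp (proj h₂),
      fun f hf => add_nonneg (comp_proj_nonneg h₁ hp₁ f hf) (comp_proj_nonneg h₂ hp₂ f hf), by
      rw [map_add, restrictDual_comp_proj, restrictDual_comp_proj]; rfl⟩
  zero_mem' := by
    have := isProbabilityMeasure_of_mem_plans hπ₀.1
    exact ⟨⟨π₀, hπ₀, PlanLE.refl⟩, 0, fun _ _ => le_rfl, map_zero _⟩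
  smul_mem' := by
    rintro a ⟨_, _⟩ ⟨π, ℓ, hp, rfl⟩
    exact ⟨π, (a : ℝ) • ℓ, fun f hf => mul_nonneg a.2 (hp f hf), map_smul _ _ _⟩

theorem one_mem_commonIntegrable : (fun _ => 1) ∈ commonIntegrable μ ν c π₀ :=
  fun _ => integrable_const _

theorem exists_nonneg_extension [IsProbabilityMeasure ν] (hc : Measurable c)
    (hπ₀ : π₀ ∈ finitePlans μ ν c) {p : ℝ}
    (hp : ∀ π : PlansAbove μ ν c π₀, ∀ π' ∈ plans μ ν, PlanLE π' π.1 →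
      ENNReal.ofReal p ≤ ∫⁻ z, c z ∂π') :
    ∃ G : dualUnion hπ₀ →ₗ[ℝ] ℝ,
      (∀ m : dualUnion hπ₀, (∀ (φ : X → ℝ) (ψ : Y → ℝ) (hφ : Integrable φ μ) (hψ : Integrable ψ ν),
        m.1 ⟨_, oplus_mem_commonIntegrable hφ hψ⟩ =
          m.1 ⟨_, one_mem_commonIntegrable⟩ * (∫ x, φ x ∂μ + ∫ y, ψ y ∂ν)) →
        G m = m.1 ⟨_, cost_mem_commonIntegrable hc⟩ - p * m.1 ⟨_, one_mem_commonIntegrable⟩) ∧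
      ∀ m ∈ dualUnionCone hπ₀, 0 ≤ G m := by
  let W : Submodule ℝ (dualUnion hπ₀) :=
    { carrier := {m | ∀ (φ : X → ℝ) (ψ : Y → ℝ) (hφ : Integrable φ μ) (hψ : Integrable ψ ν),
        m.1 ⟨_, oplus_mem_commonIntegrable hφ hψ⟩ =
          m.1 ⟨_, one_mem_commonIntegrable⟩ * (∫ x, φ x ∂μ + ∫ y, ψ y ∂ν)}
      add_mem' := fun {m m'} h h' φ ψ hφ hψ => by
        have h1 := h φ ψ hφ hψ
        have h2 := h' φ ψ hφ hψ
        rw [Submodule.coe_add, LinearMap.add_apply, LinearMap.add_apply, h1, h2, add_mul]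
      zero_mem' := fun φ ψ hφ hψ => (zero_mul _).symm
      smul_mem' := fun a m h φ ψ hφ hψ => by
        have h1 := h φ ψ hφ hψ
        rw [Submodule.coe_smul, LinearMap.smul_apply, LinearMap.smul_apply, h1, smul_eq_mul,
          smul_eq_mul, mul_assoc] }
  let G₀ : dualUnion hπ₀ →ₗ[ℝ] ℝ :=
    { toFun := fun m => m.1 ⟨_, cost_mem_commonIntegrable hc⟩ -
        p * m.1 ⟨_, one_mem_commonIntegrable⟩
      map_add' := fun m m' => by
        rw [Submodule.coe_add, LinearMap.add_apply, LinearMap.add_apply]; ring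
      map_smul' := fun a m => by
        rw [Submodule.coe_smul, LinearMap.smul_apply, LinearMap.smul_apply, RingHom.id_apply,
          smul_eq_mul, smul_eq_mul, smul_eq_mul]; ring }
  let T : dualUnion hπ₀ →ₗ.[ℝ] ℝ := { domain := W, toFun := G₀ ∘ₗ W.subtype }
  have hnonneg : ∀ x : T.domain, (x : dualUnion hπ₀) ∈ dualUnionCone hπ₀ → 0 ≤ T x := by
    rintro ⟨m, hm⟩ ⟨π, ℓ, hℓ, e⟩
    change 0 ≤ m.1 ⟨_, cost_mem_commonIntegrable hc⟩ - p * m.1 ⟨_, one_mem_commonIntegrable⟩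
    have := mul_le_apply_costL1 hc π.2.1 (hp π) ℓ hℓ (m.1 ⟨_, one_mem_commonIntegrable⟩) ?_
    · rw [mul_comm, sub_nonneg]
      refine this.trans_eq ?_
      rw [← e]
      rfl
    · intro φ ψ f hφ hψ hf
      rw [← hm φ ψ hφ hψ]
      rw [← e, restrictDual_apply]
      congr 1
      exact Lp.ext (hf.trans (Integrable.coeFn_toL1 _).symm)
  have hdense : ∀ y, ∃ x : T.domain, (x : dualUnion hπ₀) + y ∈ dualUnionCone hπ₀ := by
    rintro ⟨_, π, ℓ, rfl⟩
    refine ⟨⟨⟨restrictDual π (‖ℓ‖ • L1.integralCLM), π, _, rfl⟩, ?_⟩, π,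
      ‖ℓ‖ • L1.integralCLM + ℓ, norm_smul_integral_add_nonneg ℓ, map_add _ _ _⟩
    intro φ ψ hφ hψ
    change ‖ℓ‖ * L1.integralCLM _ = ‖ℓ‖ * L1.integralCLM _ * _
    rw [integralCLM_apply, integralCLM_apply, integral_congr_ae (Integrable.coeFn_toL1 _),
      integral_congr_ae (Integrable.coeFn_toL1 _), integral_oplus π.2.1.1 hφ hψ]
    simp
  obtain ⟨G, hG, hG0⟩ := riesz_extension (dualUnionCone hπ₀) T hnonneg hdense
  exact ⟨G, fun m hm => hG ⟨m, hm⟩, hG0⟩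

/-- The optimal projective family, with `L¹_S(π)**` described as the annihilator of the annihilator
of `L¹_S(π)`. -/
theorem exists_projectiveFamily [IsProbabilityMeasure ν] (hc : Measurable c)
    (hπ₀ : π₀ ∈ finitePlans μ ν c) {p : ℝ}
    (hp : ∀ π : PlansAbove μ ν c π₀, ∀ π' ∈ plans μ ν, PlanLE π' π.1 →
      ENNReal.ofReal p ≤ ∫⁻ z, c z ∂π') :
    ∃ H : ∀ π : PlansAbove μ ν c π₀, Bidual (Lp ℝ 1 π.1), IsProjectiveFamily H ∧
      ∀ π : PlansAbove μ ν c π₀,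
        (∀ ℓ : StrongDual ℝ (Lp ℝ 1 π.1), (∀ f ∈ L1S μ ν π.1, ℓ f = 0) → H π ℓ = 0) ∧
        BidualLE (H π) (toBidual (costL1 c hc π.2.1.2)) ∧ pairing (H π) = p := by
  obtain ⟨G, hG, hG0⟩ := exists_nonneg_extension hc hπ₀ hp
  let Φ : ∀ π : PlansAbove μ ν c π₀, StrongDual ℝ (Lp ℝ 1 π.1) →ₗ[ℝ] dualUnion hπ₀ := fun π =>
    (restrictDual π).codRestrict _ fun ℓ => ⟨π, ℓ, rfl⟩
  have hpos : ∀ (π : PlansAbove μ ν c π₀) (ℓ : StrongDual ℝ (Lp ℝ 1 π.1)),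
      (∀ f : Lp ℝ 1 π.1, 0 ≤ f → 0 ≤ ℓ f) → 0 ≤ G (Φ π ℓ) := fun π ℓ hℓ =>
    hG0 _ ⟨π, ℓ, hℓ, rfl⟩
  have hbound : ∀ (π : PlansAbove μ ν c π₀) (ℓ : StrongDual ℝ (Lp ℝ 1 π.1)),
      ‖(G ∘ₗ Φ π) ℓ‖ ≤ G (Φ π L1.integralCLM) * ‖ℓ‖ := fun π ℓ => by
    have h1 := hpos π _ (norm_smul_integral_add_nonneg ℓ)
    have h2 := hpos π _ (norm_smul_integral_add_nonneg (-ℓ))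
    rw [map_add, map_add, map_smul, map_smul, smul_eq_mul] at h1 h2
    rw [map_neg, map_neg, norm_neg] at h2
    rw [Real.norm_eq_abs, abs_le]
    change -_ ≤ G (Φ π ℓ) ∧ G (Φ π ℓ) ≤ _
    constructor <;> linarith
  let g : ∀ π : PlansAbove μ ν c π₀, Bidual (Lp ℝ 1 π.1) := fun π =>
    (G ∘ₗ Φ π).mkContinuous _ (hbound π)
  have hHval : ∀ (π : PlansAbove μ ν c π₀) (ℓ : StrongDual ℝ (Lp ℝ 1 π.1)),
      (toBidual (costL1 c hc π.2.1.2) - g π) ℓ = ℓ (costL1 c hc π.2.1.2) - G (Φ π ℓ) :=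
    fun _ _ => rfl
  refine ⟨fun π => toBidual (costL1 c hc π.2.1.2) - g π, fun π₁ π₂ h => ?_, fun π => ⟨?_, ?_, ?_⟩⟩
  · refine ContinuousLinearMap.ext fun ℓ => ?_
    change (toBidual (costL1 c hc π₂.2.1.2) - g π₂) (ℓ.comp (proj h)) = _
    have e : Φ π₂ (ℓ.comp (proj h)) = Φ π₁ ℓ := Subtype.ext (restrictDual_comp_proj h ℓ)
    rw [hHval, hHval, e]
    congr 1
    exact DFunLike.congr_fun (restrictDual_comp_proj h ℓ) ⟨_, cost_mem_commonIntegrable hc⟩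
  · intro ℓ hℓ
    have hS : ∀ (φ : X → ℝ) (ψ : Y → ℝ) (hφ : Integrable φ μ) (hψ : Integrable ψ ν),
        (Φ π ℓ).1 ⟨_, oplus_mem_commonIntegrable hφ hψ⟩ = 0 := fun φ ψ hφ hψ =>
      hℓ _ (Submodule.le_topologicalClosure _ (Submodule.subset_span
        ⟨φ, ψ, hφ, hψ, Integrable.coeFn_toL1 _⟩))
    have h1 : (Φ π ℓ).1 ⟨_, one_mem_commonIntegrable⟩ = 0 := by
      have := hS (fun _ => 1) (fun _ => 0) (integrable_const _) (integrable_const _)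
      simpa only [add_zero] using this
    rw [hHval, hG (Φ π ℓ) fun φ ψ hφ hψ => by rw [hS φ ψ hφ hψ, h1, zero_mul], h1, mul_zero,
      sub_zero]
    exact sub_self _
  · intro ℓ hℓ
    rw [hHval]
    exact sub_le_self _ (hpos π ℓ hℓ)
  · have h1 : (Φ π L1.integralCLM).1 ⟨_, one_mem_commonIntegrable⟩ = 1 := by
      change L1.integralCLM _ = _
      rw [integralCLM_apply, integral_congr_ae (Integrable.coeFn_toL1 _)]
      simp
    rw [pairing, hHval, hG (Φ π L1.integralCLM), h1, mul_one]
    · exact sub_sub_cancel _ _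
    · intro φ ψ hφ hψ
      rw [h1, one_mul]
      change L1.integralCLM _ = _
      rw [integralCLM_apply, integral_congr_ae (Integrable.coeFn_toL1 _),
        integral_oplus π.2.1.1 hφ hψ]

/-- The range of `M** → E**` is the annihilator of the annihilator of the subspace `M`. -/
theorem mem_range_bidualMap_subtypeL {E : Type*} [NormedAddCommGroup E] [NormedSpace ℝ E]
    (M : Submodule ℝ E) (h : Bidual E) :
    h ∈ Set.range (bidualMap M.subtypeL) ↔
      ∀ ℓ : StrongDual ℝ E, (∀ f ∈ M, ℓ f = 0) → h ℓ = 0 := by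
  constructor
  · rintro ⟨g, rfl⟩ ℓ hℓ
    change g (ℓ.comp M.subtypeL) = 0
    have : ℓ.comp M.subtypeL = 0 := ContinuousLinearMap.ext fun f => hℓ f f.2
    rw [this, map_zero]
  · intro H
    choose e he hen using fun k : StrongDual ℝ M => exists_extension_norm_eq M k
    have hcongr : ∀ ℓ ℓ' : StrongDual ℝ E, (∀ f : M, ℓ f = ℓ' f) → h ℓ = h ℓ' := fun ℓ ℓ' hl => by
      refine sub_eq_zero.1 ?_
      rw [← map_sub]
      exact H _ fun f hf => sub_eq_zero.2 (hl ⟨f, hf⟩)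
    refine ⟨LinearMap.mkContinuous
      { toFun := fun k => h (e k)
        map_add' := fun k k' => ?_
        map_smul' := fun a k => ?_ } ‖h‖ fun k => ?_, ?_⟩
    · rw [← map_add]
      refine hcongr _ _ fun f => ?_
      rw [add_apply, he, he, he, add_apply]
    · rw [RingHom.id_apply, ← map_smul]
      refine hcongr _ _ fun f => ?_
      rw [smul_apply, he, he, smul_apply]
    · rw [← hen k]
      exact h.le_opNorm _
    · refine ContinuousLinearMap.ext fun ℓ => ?_
      exact hcongr _ _ fun f => he _ f

end Family

section Duality

variable {X Y : Type*} [MeasurableSpace X] [MeasurableSpace Y] {μ : Measure X} {ν : Measure Y}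
  {c : X × Y → ℝ≥0∞} {π : Measure (X × Y)}

theorem coe_le_coe_ennreal {x : ℝ} {y : ℝ≥0∞} (h : ENNReal.ofReal x ≤ y) :
    (x : EReal) ≤ (y : EReal) :=
  calc (x : EReal) ≤ (ENNReal.ofReal x : EReal) := by
        rw [EReal.coe_ennreal_ofReal]
        exact EReal.coe_le_coe_iff.2 (le_max_left x 0)
    _ ≤ y := EReal.coe_ennreal_le_coe_ennreal_iff.2 h

theorem apply_eq_zero_of_mem_L1S {ℓ : StrongDual ℝ (Lp ℝ 1 π)}
    (hℓ : ∀ (φ : X → ℝ) (ψ : Y → ℝ) (f : Lp ℝ 1 π), Integrable φ μ → Integrable ψ ν →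
      f =ᵐ[π] (fun z => φ z.1 + ψ z.2) → ℓ f = 0) {f : Lp ℝ 1 π} (hf : f ∈ L1S μ ν π) :
    ℓ f = 0 := by
  have hle : L1S μ ν π ≤ LinearMap.ker ℓ.toLinearMap := by
    refine Submodule.topologicalClosure_minimal _ (Submodule.span_le.2 ?_)
      (isClosed_eq ℓ.continuous continuous_const)
    rintro f ⟨φ, ψ, hφ, hψ, h⟩
    exact hℓ φ ψ f hφ hψ h
  exact hle hf

theorem intFun_costL1 (hc : Measurable c) (hπ : ∫⁻ z, c z ∂π ≠ ∞) [IsFiniteMeasure π]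
    {ρ : Measure (X × Y)} [IsFiniteMeasure ρ] (hρ : PlanLE ρ π) :
    intFun hρ (costL1 c hc hπ) = (∫⁻ z, c z ∂ρ).toReal := by
  have hcae : costL1 c hc hπ =ᵐ[ρ] fun z => (c z).toReal :=
    hρ.1.ae_eq (Integrable.coeFn_toL1 _)
  rw [intFun_apply, integral_congr_ae hcae]
  exact integral_toReal hc.aemeasurable (hρ.1.ae_le (ae_lt_top hc hπ))

variable [IsProbabilityMeasure μ]

/-- Weak duality for the bidual problem. -/
theorem pairing_le_lintegral (hc : Measurable c) (hπ : π ∈ finitePlans μ ν c)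
    {h : Bidual (Lp ℝ 1 π)} (hh : h ∈ bidualFeasible μ ν c hc π hπ.2) {π' : Measure (X × Y)}
    (hπ' : π' ∈ plans μ ν) (hle : PlanLE π' π) :
    ENNReal.ofReal (pairing h) ≤ ∫⁻ z, c z ∂π' := by
  have := isProbabilityMeasure_of_mem_plans hπ.1
  have := isProbabilityMeasure_of_mem_plans hπ'
  have h0 : h (intFun hle - L1.integralCLM) = 0 := by
    refine (mem_range_bidualMap_subtypeL _ h).1 hh.1 _ fun f hf => ?_
    refine apply_eq_zero_of_mem_L1S (μ := μ) (ν := ν) (fun φ ψ f hφ hψ hf => ?_) hf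
    rw [sub_apply, intFun_apply, integralCLM_apply, integral_congr_ae hf,
      integral_congr_ae (hle.1.ae_eq hf), integral_oplus hπ.1 hφ hψ, integral_oplus hπ' hφ hψ,
      sub_self]
  rw [map_sub, sub_eq_zero] at h0
  have h1 := hh.2 _ (intFun_nonneg hle)
  rw [h0] at h1
  have h2 : pairing h ≤ (∫⁻ z, c z ∂π').toReal := h1.trans_eq (intFun_costL1 hc hπ.2 hle)
  exact ENNReal.ofReal_le_of_le_toReal h2

theorem dualBidual_le_primalAt (hc : Measurable c) (hπ : π ∈ finitePlans μ ν c) :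
    dualBidual μ ν c hc π hπ.2 ≤ (primalAt μ ν c π : EReal) :=
  iSup₂_le fun _ hh => coe_le_coe_ennreal
    (le_iInf₂ fun _ hπ' => pairing_le_lintegral hc hπ hh hπ'.1 hπ'.2)

theorem dualEps_le (hπ : π ∈ plans μ ν) {π' : Measure (X × Y)} (hc : Measurable c)
    (hπ' : π' ∈ plans μ ν) (hle : PlanLE π' π) (ε : ℝ) :
    dualEps μ ν c π ε ≤
      ((essSup (π'.rnDeriv π) π * ENNReal.ofReal ε + ∫⁻ z, c z ∂π' : ℝ≥0∞) : EReal) := by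
  have := isProbabilityMeasure_of_mem_plans hπ
  have := isProbabilityMeasure_of_mem_plans hπ'
  refine iSup₂_le fun p hp => coe_le_coe_ennreal ?_
  rw [← integral_oplus hπ' hp.1 hp.2.1]
  have hint : Integrable (fun z : X × Y => p.1 z.1 + p.2 z.2) π' :=
    (integrable_fst hπ' hp.1).add (integrable_snd hπ' hp.2.1)
  calc ENNReal.ofReal (∫ z, (p.1 z.1 + p.2 z.2) ∂π')
      ≤ ∫⁻ z, ENNReal.ofReal (p.1 z.1 + p.2 z.2) ∂π' := by
        refine ENNReal.ofReal_le_of_le_toReal ?_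
        rw [integral_eq_lintegral_pos_part_sub_lintegral_neg_part hint]
        exact sub_le_self _ ENNReal.toReal_nonneg
    _ ≤ ∫⁻ z, ((ENNReal.ofReal (p.1 z.1 + p.2 z.2) - c z) + c z) ∂π' :=
        lintegral_mono fun z => le_tsub_add
    _ = ∫⁻ z, (ENNReal.ofReal (p.1 z.1 + p.2 z.2) - c z) ∂π' + ∫⁻ z, c z ∂π' :=
        lintegral_add_right _ hc
    _ ≤ essSup (π'.rnDeriv π) π * ENNReal.ofReal ε + ∫⁻ z, c z ∂π' := by
        gcongr
        refine (lintegral_mono' hle.le_smul le_rfl).trans ?_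
        rw [lintegral_smul_measure, smul_eq_mul]
        gcongr
        exact hp.2.2

/-- The existence of an element of the bidual problem of value `p` provides almost feasible pairs
of value `p`. -/
theorem exists_oplus_near [IsProbabilityMeasure ν] (hc : Measurable c)
    (hπ : π ∈ finitePlans μ ν c) {h : Bidual (Lp ℝ 1 π)}
    (hh : h ∈ bidualFeasible μ ν c hc π hπ.2) {ε : ℝ} (hε : 0 < ε) :
    ∃ (φ : X → ℝ) (ψ : Y → ℝ) (f g : Lp ℝ 1 π), Integrable φ μ ∧ Integrable ψ ν ∧
      f =ᵐ[π] (fun z => φ z.1 + ψ z.2) ∧ ∫ x, φ x ∂μ + ∫ y, ψ y ∂ν = pairing h ∧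
      g ≤ costL1 c hc hπ.2 ∧ ‖f - g‖ < ε := by
  have := isProbabilityMeasure_of_mem_plans hπ.1
  set A : Set (Lp ℝ 1 π) := {f | ∃ (φ : X → ℝ) (ψ : Y → ℝ), Integrable φ μ ∧ Integrable ψ ν ∧
    f =ᵐ[π] (fun z => φ z.1 + ψ z.2) ∧ ∫ x, φ x ∂μ + ∫ y, ψ y ∂ν = pairing h} with hA
  set B : Set (Lp ℝ 1 π) := Set.Iic (costL1 c hc hπ.2) with hB
  by_contra! hcon
  have hdisj : Disjoint (Metric.thickening ε B) A := by
    refine Set.disjoint_left.2 fun f hfB hfA => ?_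
    obtain ⟨φ, ψ, hφ, hψ, hf, hval⟩ := hfA
    obtain ⟨g, hg, hfg⟩ := Metric.mem_thickening_iff.1 hfB
    rw [dist_eq_norm] at hfg
    exact absurd hfg (not_lt.2 (hcon φ ψ f g hφ hψ hf hval hg))
  have hAconv : Convex ℝ A := by
    rintro f ⟨φ, ψ, hφ, hψ, hf, hval⟩ f' ⟨φ', ψ', hφ', hψ', hf', hval'⟩ a b _ _ hab
    refine ⟨fun x => a * φ x + b * φ' x, fun y => a * ψ y + b * ψ' y,
      (hφ.const_mul a).add (hφ'.const_mul b), (hψ.const_mul a).add (hψ'.const_mul b), ?_, ?_⟩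
    · filter_upwards [hf, hf', Lp.coeFn_add (a • f) (b • f'), Lp.coeFn_smul a f,
        Lp.coeFn_smul b f'] with z h1 h2 h3 h4 h5
      rw [h3, Pi.add_apply, h4, h5, Pi.smul_apply, Pi.smul_apply, h1, h2, smul_eq_mul, smul_eq_mul]
      ring
    · rw [integral_add (hφ.const_mul a) (hφ'.const_mul b),
        integral_add (hψ.const_mul a) (hψ'.const_mul b), integral_const_mul, integral_const_mul,
        integral_const_mul, integral_const_mul]
      linear_combination a * hval + b * hval' + pairing h * hab
  have hBconv : Convex ℝ B := by
    intro f hf g hg a b ha hb hab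
    have hf' : f ≤ costL1 c hc hπ.2 := hf
    have hg' : g ≤ costL1 c hc hπ.2 := hg
    refine (Lp.coeFn_le _ _).1 ?_
    filter_upwards [(Lp.coeFn_le f _).2 hf', (Lp.coeFn_le g _).2 hg', Lp.coeFn_add (a • f) (b • g),
      Lp.coeFn_smul a f, Lp.coeFn_smul b g] with z h1 h2 h3 h4 h5
    rw [h3, Pi.add_apply, h4, h5, Pi.smul_apply, Pi.smul_apply, smul_eq_mul, smul_eq_mul,
      ← one_mul (costL1 c hc hπ.2 z), ← hab, add_mul]
    exact add_le_add (mul_le_mul_of_nonneg_left h1 ha) (mul_le_mul_of_nonneg_left h2 hb)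
  obtain ⟨ℓ, u, hℓB, hℓA⟩ := geometric_hahn_banach_open (hBconv.thickening ε)
    Metric.isOpen_thickening hAconv hdisj
  have hℓc : ∀ g, g ≤ costL1 c hc hπ.2 → ℓ g < u := fun g hg =>
    hℓB g (Metric.self_subset_thickening hε B hg)
  have hnonneg : ∀ f : Lp ℝ 1 π, 0 ≤ f → 0 ≤ ℓ f := by
    intro f hf
    by_contra! hneg
    have h1 : ∀ n : ℕ, ℓ (costL1 c hc hπ.2) + n * (-ℓ f) < u := fun n => by
      have := hℓc (costL1 c hc hπ.2 - n • f) (sub_le_self _ (nsmul_nonneg hf n))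
      rw [map_sub, map_nsmul, nsmul_eq_mul] at this
      linarith
    obtain ⟨n, hn⟩ := exists_nat_gt ((u - ℓ (costL1 c hc hπ.2)) / (-ℓ f))
    rw [div_lt_iff₀ (by linarith)] at hn
    linarith [h1 n]
  set e : Lp ℝ 1 π := (integrable_const (1 : ℝ)).toL1 (fun _ : X × Y => (1 : ℝ)) with he
  have heae : e =ᵐ[π] fun _ => 1 := Integrable.coeFn_toL1 _
  have hmean : ∀ (φ : X → ℝ) (ψ : Y → ℝ) (f : Lp ℝ 1 π), Integrable φ μ → Integrable ψ ν →
      f =ᵐ[π] (fun z => φ z.1 + ψ z.2) → ∀ t : ℝ,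
      u ≤ pairing h * ℓ e + t * (ℓ f - (∫ x, φ x ∂μ + ∫ y, ψ y ∂ν) * ℓ e) := by
    intro φ ψ f hφ hψ hf t
    set w : ℝ := ∫ x, φ x ∂μ + ∫ y, ψ y ∂ν with hw
    have hmem : (pairing h - t * w) • e + t • f ∈ A := by
      refine ⟨fun x => (pairing h - t * w) + t * φ x, fun y => t * ψ y,
        (integrable_const _).add (hφ.const_mul t), hψ.const_mul t, ?_, ?_⟩
      · filter_upwards [hf, heae, Lp.coeFn_add ((pairing h - t * w) • e) (t • f),
          Lp.coeFn_smul (pairing h - t * w) e, Lp.coeFn_smul t f] with z h1 h2 h3 h4 h5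
        rw [h3, Pi.add_apply, h4, h5, Pi.smul_apply, Pi.smul_apply, h1, h2, smul_eq_mul,
          smul_eq_mul]
        ring
      · rw [integral_add (integrable_const _) (hφ.const_mul t), integral_const_mul,
          integral_const_mul, integral_const, probReal_univ, one_smul]
        linear_combination -t * hw
    have := hℓA _ hmem
    rw [map_add, map_smul, map_smul, smul_eq_mul, smul_eq_mul] at this
    linarith
  have hzero : ∀ f ∈ L1S μ ν π, (ℓ - ℓ e • (L1.integralCLM : StrongDual ℝ (Lp ℝ 1 π))) f = 0 := by
    intro f hf
    refine apply_eq_zero_of_mem_L1S (μ := μ) (ν := ν) (fun φ ψ f hφ hψ hf => ?_) hf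
    have h1 := hmean φ ψ f hφ hψ hf
    rw [sub_apply, smul_apply, integralCLM_apply, integral_congr_ae hf,
      integral_oplus hπ.1 hφ hψ, smul_eq_mul, mul_comm (ℓ e)]
    by_contra hne
    have h2 := h1 ((u - pairing h * ℓ e - 1) / (ℓ f - (∫ x, φ x ∂μ + ∫ y, ψ y ∂ν) * ℓ e))
    rw [div_mul_cancel₀ _ hne] at h2
    linarith
  have hval := (mem_range_bidualMap_subtypeL _ h).1 hh.1 _ hzero
  rw [map_sub, map_smul, sub_eq_zero, smul_eq_mul] at hval
  have h1 : h ℓ ≤ ℓ (costL1 c hc hπ.2) := hh.2 ℓ hnonneg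
  have h2 := hmean (fun _ => 0) (fun _ => 0) 0 (integrable_const _) (integrable_const _)
    (by simp only [add_zero]; exact Lp.coeFn_zero ℝ 1 π) 0
  have h3 := hℓc _ le_rfl
  have h4 : h ℓ = ℓ e * pairing h := hval
  linarith

theorem pairing_le_dualEps [IsProbabilityMeasure ν] (hc : Measurable c)
    (hπ : π ∈ finitePlans μ ν c) {h : Bidual (Lp ℝ 1 π)}
    (hh : h ∈ bidualFeasible μ ν c hc π hπ.2) {ε : ℝ} (hε : 0 < ε) :
    (pairing h : EReal) ≤ dualEps μ ν c π ε := by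
  obtain ⟨φ, ψ, f, g, hφ, hψ, hf, hval, hg, hfg⟩ := exists_oplus_near hc hπ hh hε
  rw [← hval]
  refine le_iSup₂ (f := fun (p : (X → ℝ) × (Y → ℝ)) _ =>
    ((∫ x, p.1 x ∂μ + ∫ y, p.2 y ∂ν : ℝ) : EReal)) (φ, ψ) ⟨hφ, hψ, ?_⟩
  calc ∫⁻ z, (ENNReal.ofReal (φ z.1 + ψ z.2) - c z) ∂π
      ≤ ∫⁻ z, ENNReal.ofReal ‖(f - g) z‖ ∂π := by
        refine lintegral_mono_ae ?_
        filter_upwards [hf, Lp.coeFn_sub f g, (Lp.coeFn_le g _).2 hg, ae_lt_top hc hπ.2,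
          Integrable.coeFn_toL1 (integrable_toReal_of_lintegral_ne_top hc.aemeasurable hπ.2)]
          with z h1 h2 h3 h4 h5
        have h6 : g z ≤ (c z).toReal := h3.trans_eq h5
        rw [h2, Pi.sub_apply, ← h1, tsub_le_iff_right, ← ENNReal.ofReal_toReal h4.ne,
          ← ENNReal.ofReal_add (norm_nonneg _) ENNReal.toReal_nonneg]
        refine ENNReal.ofReal_le_ofReal ?_
        linarith [Real.le_norm_self (f z - g z)]
    _ = ENNReal.ofReal ‖f - g‖ := by
        rw [L1.norm_eq_integral_norm, ofReal_integral_eq_lintegral_ofReal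
          (integrable_coeFn _).norm (Eventually.of_forall fun z => norm_nonneg _)]
    _ ≤ ENNReal.ofReal ε := ENNReal.ofReal_le_ofReal hfg.le

theorem tendsto_dualEps [IsProbabilityMeasure ν] (hc : Measurable c)
    (hπ : π ∈ finitePlans μ ν c) {h : Bidual (Lp ℝ 1 π)}
    (hh : h ∈ bidualFeasible μ ν c hc π hπ.2)
    (hval : (pairing h : EReal) = (primalAt μ ν c π : EReal)) :
    Tendsto (dualEps μ ν c π) (𝓝[>] (0 : ℝ)) (𝓝 (primalAt μ ν c π : EReal)) := by
  refine tendsto_order.2 ⟨fun b hb => ?_, fun b hb => ?_⟩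
  · filter_upwards [self_mem_nhdsWithin] with ε hε
    exact (hb.trans_eq hval.symm).trans_le (pairing_le_dualEps hc hπ hh hε)
  · have hex : ∃ π', (π' ∈ plans μ ν ∧ PlanLE π' π) ∧ ((∫⁻ z, c z ∂π' : ℝ≥0∞) : EReal) < b := by
      by_contra! hcon
      refine absurd hb (not_lt.2 ?_)
      have hb0 : 0 ≤ b := (EReal.coe_ennreal_nonneg _).trans hb.le
      rw [← EReal.coe_toENNReal hb0]
      refine EReal.coe_ennreal_le_coe_ennreal_iff.2 (le_iInf₂ fun π' hπ' => ?_)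
      rw [← EReal.coe_ennreal_le_coe_ennreal_iff, EReal.coe_toENNReal hb0]
      exact hcon π' hπ'
    obtain ⟨π', ⟨hπ', hle⟩, hlt⟩ := hex
    have hlim : Tendsto (fun ε : ℝ => ((essSup (π'.rnDeriv π) π * ENNReal.ofReal ε +
        ∫⁻ z, c z ∂π' : ℝ≥0∞) : EReal)) (𝓝[>] 0) (𝓝 ((∫⁻ z, c z ∂π' : ℝ≥0∞) : EReal)) := by
      refine (continuous_coe_ennreal_ereal.tendsto _).comp ?_
      have h1 : Tendsto (fun ε : ℝ => ENNReal.ofReal ε) (𝓝[>] 0) (𝓝 0) := by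
        have := ENNReal.continuous_ofReal.tendsto 0
        rw [ENNReal.ofReal_zero] at this
        exact this.mono_left nhdsWithin_le_nhds
      have h2 := (ENNReal.Tendsto.const_mul h1 (Or.inr hle.2.ne)).add_const (∫⁻ z, c z ∂π')
      rwa [mul_zero, zero_add] at h2
    filter_upwards [hlim.eventually_lt_const hlt] with ε hε
    exact (dualEps_le hπ.1 hc hπ' hle ε).trans_lt hε

end Duality

section Attainment

theorem lintegral_le_liminf_of_lowerSemicontinuous {Z : Type*} [TopologicalSpace Z]
    [MeasurableSpace Z] [OpensMeasurableSpace Z] [HasOuterApproxClosed Z] {c : Z → ℝ≥0∞}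
    (hc : LowerSemicontinuous c) {P : ProbabilityMeasure Z} {Q : ℕ → ProbabilityMeasure Z}
    (hQ : Tendsto Q atTop (𝓝 P)) :
    ∫⁻ z, c z ∂(P : Measure Z) ≤ liminf (fun n => ∫⁻ z, c z ∂(Q n : Measure Z)) atTop := by
  have hcm : Measurable c := hc.measurable
  have hle : ∀ N : ℕ, ∫⁻ z, min (c z) N ∂(P : Measure Z) ≤
      liminf (fun n => ∫⁻ z, c z ∂(Q n : Measure Z)) atTop := by
    intro N
    have hfin : ∀ z, min (c z) N ≠ ∞ := fun z =>
      ne_top_of_le_ne_top (ENNReal.natCast_ne_top N) (min_le_right _ _)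
    have hm : Measurable fun z => (min (c z) (N : ℝ≥0∞)).toReal :=
      (hcm.min measurable_const).ennreal_toReal
    have hcake : ∀ m : Measure Z, ∫⁻ z, min (c z) N ∂m =
        ∫⁻ t in Set.Ioi (0 : ℝ), m {z | t < (min (c z) (N : ℝ≥0∞)).toReal} := fun m => by
      rw [← lintegral_eq_lintegral_meas_lt m (Eventually.of_forall fun z => ENNReal.toReal_nonneg)
        hm.aemeasurable]
      exact lintegral_congr fun z => (ENNReal.ofReal_toReal (hfin z)).symm
    have hopen : ∀ t ∈ Set.Ioi (0 : ℝ), IsOpen {z | t < (min (c z) (N : ℝ≥0∞)).toReal} := by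
      intro t ht
      have e : {z | t < (min (c z) (N : ℝ≥0∞)).toReal} =
          {z | ENNReal.ofReal t < c z} ∩ {_z | ENNReal.ofReal t < N} := by
        ext z
        change t < (min (c z) (N : ℝ≥0∞)).toReal ↔ ENNReal.ofReal t < c z ∧ ENNReal.ofReal t < N
        rw [← ENNReal.ofReal_lt_iff_lt_toReal (le_of_lt ht) (hfin z), lt_min_iff]
      rw [e]
      exact (hc.isOpen_preimage _).inter isOpen_const
    calc ∫⁻ z, min (c z) N ∂(P : Measure Z)
        = ∫⁻ t in Set.Ioi (0 : ℝ), (P : Measure Z) {z | t < (min (c z) (N : ℝ≥0∞)).toReal} :=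
          hcake _
      _ ≤ ∫⁻ t in Set.Ioi (0 : ℝ), liminf (fun n =>
            (Q n : Measure Z) {z | t < (min (c z) (N : ℝ≥0∞)).toReal}) atTop :=
          setLIntegral_mono' measurableSet_Ioi fun t ht =>
            ProbabilityMeasure.le_liminf_measure_open_of_tendsto hQ (hopen t ht)
      _ ≤ liminf (fun n => ∫⁻ t in Set.Ioi (0 : ℝ),
            (Q n : Measure Z) {z | t < (min (c z) (N : ℝ≥0∞)).toReal}) atTop :=
          lintegral_liminf_le fun n => Antitone.measurable fun s t hst =>
            measure_mono fun z hz => lt_of_le_of_lt hst hz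
      _ = liminf (fun n => ∫⁻ z, min (c z) N ∂(Q n : Measure Z)) atTop := by simp_rw [hcake]
      _ ≤ liminf (fun n => ∫⁻ z, c z ∂(Q n : Measure Z)) atTop :=
          liminf_le_liminf (Eventually.of_forall fun n => lintegral_mono fun z => min_le_left _ _)
  have hsup : ∫⁻ z, c z ∂(P : Measure Z) = ⨆ N : ℕ, ∫⁻ z, min (c z) N ∂(P : Measure Z) := by
    rw [← lintegral_iSup (fun N => hcm.min measurable_const)
      (fun N M h z => min_le_min le_rfl (by exact_mod_cast h))]
    refine lintegral_congr fun z => ?_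
    change c z = ⨆ N : ℕ, c z ⊓ (N : ℝ≥0∞)
    rw [← inf_iSup_eq, ENNReal.iSup_natCast, inf_top_eq]
  rw [hsup]
  exact iSup_le hle

variable {X Y : Type*}
  [TopologicalSpace X] [PolishSpace X] [MeasurableSpace X] [BorelSpace X]
  [TopologicalSpace Y] [PolishSpace Y] [MeasurableSpace Y] [BorelSpace Y]
  {μ : Measure X} {ν : Measure Y} [IsProbabilityMeasure μ] [IsProbabilityMeasure ν]

variable (μ ν) in
theorem isCompact_plans :
    IsCompact {P : ProbabilityMeasure (X × Y) | (P : Measure (X × Y)) ∈ plans μ ν} := by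
  set S : Set (ProbabilityMeasure (X × Y)) := {P | (P : Measure (X × Y)) ∈ plans μ ν} with hS
  have hclosed : IsClosed S := by
    have h1 : IsClosed {P : ProbabilityMeasure (X × Y) |
        P.map (measurable_fst (α := X) (β := Y)).aemeasurable = (⟨μ, inferInstance⟩ :
          ProbabilityMeasure X)} :=
      isClosed_eq (ProbabilityMeasure.continuous_map continuous_fst) continuous_const
    have h2 : IsClosed {P : ProbabilityMeasure (X × Y) |
        P.map (measurable_snd (α := X) (β := Y)).aemeasurable = (⟨ν, inferInstance⟩ :
          ProbabilityMeasure Y)} :=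
      isClosed_eq (ProbabilityMeasure.continuous_map continuous_snd) continuous_const
    convert h1.inter h2 using 1
    ext P
    exact ⟨fun h => ⟨Subtype.ext h.1, Subtype.ext h.2⟩,
      fun h => ⟨congrArg Subtype.val h.1, congrArg Subtype.val h.2⟩⟩
  have htight : IsTightMeasureSet
      {((P : ProbabilityMeasure (X × Y)) : Measure (X × Y)) | P ∈ S} := by
    refine IsTightMeasureSet.prodMk
      ((isTightMeasureSet_singleton (μ := μ)).subset ?_)
      ((isTightMeasureSet_singleton (μ := ν)).subset ?_)
    · rintro _ ⟨_, ⟨P, hP, rfl⟩, rfl⟩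
      exact hP.1
    · rintro _ ⟨_, ⟨P, hP, rfl⟩, rfl⟩
      exact hP.2
  rw [← hclosed.closure_eq]
  exact isCompact_closure_of_isTightMeasureSet htight

/-- For a lower semicontinuous cost the primal problem has an optimizer. -/
theorem primalAttained_of_lowerSemicontinuous {c : X × Y → ℝ≥0∞} (hc : LowerSemicontinuous c) :
    PrimalAttained μ ν c := by
  have hne : ((fun π : Measure (X × Y) => ∫⁻ z, c z ∂π) '' plans μ ν).Nonempty :=
    ⟨_, μ.prod ν, ⟨by simp, by simp⟩, rfl⟩
  have hinf : primal μ ν c = sInf ((fun π : Measure (X × Y) => ∫⁻ z, c z ∂π) '' plans μ ν) := by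
    rw [sInf_image]; rfl
  obtain ⟨u, -, hu, huS⟩ := exists_seq_tendsto_sInf hne (OrderBot.bddBelow _)
  choose π hπ hπu using huS
  have hprob : ∀ n, IsProbabilityMeasure (π n) := fun n => isProbabilityMeasure_of_mem_plans (hπ n)
  obtain ⟨P, hP, k, hk, hlim⟩ := (isCompact_plans μ ν).isSeqCompact
    (x := fun n => ⟨π n, hprob n⟩) hπ
  have hP' : (P : Measure (X × Y)) ∈ plans μ ν := hP
  refine ⟨P, hP', le_antisymm ?_ (iInf₂_le _ hP')⟩
  refine (lintegral_le_liminf_of_lowerSemicontinuous hc hlim).trans (le_of_eq ?_)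
  rw [hinf]
  refine Tendsto.liminf_eq ((hu.comp hk.tendsto_atTop).congr fun n => ?_)
  exact (hπu _).symm

end Attainment

section Values

variable {X Y : Type*} [MeasurableSpace X] [MeasurableSpace Y] {μ : Measure X} {ν : Measure Y}
  [IsProbabilityMeasure μ] {c : X × Y → ℝ≥0∞} {π₀ : Measure (X × Y)}

theorem primalAt_le_lintegral {π : Measure (X × Y)} (hπ : π ∈ plans μ ν) :
    primalAt μ ν c π ≤ ∫⁻ z, c z ∂π :=
  have := isProbabilityMeasure_of_mem_plans hπ
  iInf₂_le π ⟨hπ, PlanLE.refl⟩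

theorem primalAt_antitone {π₁ π₂ : Measure (X × Y)} (h₁ : π₁ ∈ plans μ ν) (h₂ : π₂ ∈ plans μ ν)
    (h : PlanLE π₁ π₂) : primalAt μ ν c π₂ ≤ primalAt μ ν c π₁ := by
  have := isProbabilityMeasure_of_mem_plans h₁
  have := isProbabilityMeasure_of_mem_plans h₂
  refine le_iInf₂ fun π' hπ' => ?_
  have := isProbabilityMeasure_of_mem_plans hπ'.1
  exact iInf₂_le π' ⟨hπ'.1, hπ'.2.trans h⟩

theorem primalAt_eq (hπ₀ : π₀ ∈ finitePlans μ ν c)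
    (hmin : primalAt μ ν c π₀ = ⨅ π ∈ finitePlans μ ν c, primalAt μ ν c π)
    (π : PlansAbove μ ν c π₀) : primalAt μ ν c π.1 = primalAt μ ν c π₀ :=
  le_antisymm (primalAt_antitone hπ₀.1 π.2.1.1 π.2.2) (hmin.le.trans (iInf₂_le π.1 π.2.1))

theorem primal_eq_primalAt (hπ₀ : π₀ ∈ finitePlans μ ν c)
    (hmin : primalAt μ ν c π₀ = ⨅ π ∈ finitePlans μ ν c, primalAt μ ν c π)
    (h : PrimalAttained μ ν c) : primalAt μ ν c π₀ = primal μ ν c := by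
  refine le_antisymm ?_ (le_iInf₂ fun π' hπ' => iInf₂_le π' hπ'.1)
  obtain ⟨π, hπ, hval⟩ := h
  rw [← hval]
  have hfin : π ∈ finitePlans μ ν c :=
    ⟨hπ, ne_top_of_le_ne_top hπ₀.2 (hval.trans_le (iInf₂_le π₀ hπ₀.1))⟩
  exact hmin.le.trans ((iInf₂_le π hfin).trans (primalAt_le_lintegral hπ))

end Values

end

end TransportBidual

open TransportBidual in
theorem theorem4p2
    {X Y : Type*}
    [TopologicalSpace X] [PolishSpace X] [MeasurableSpace X] [BorelSpace X]
    [TopologicalSpace Y] [PolishSpace Y] [MeasurableSpace Y] [BorelSpace Y]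
    (μ : Measure X) (ν : Measure Y) [IsProbabilityMeasure μ] [IsProbabilityMeasure ν]
    (c : X × Y → ℝ≥0∞) (hc : Measurable c)
    (π₀ : Measure (X × Y)) (hπ₀ : π₀ ∈ TransportBidual.finitePlans μ ν c)
    (hmin : TransportBidual.primalAt μ ν c π₀ =
      ⨅ π ∈ TransportBidual.finitePlans μ ν c, TransportBidual.primalAt μ ν c π) :
    (∃ H : ∀ π : TransportBidual.PlansAbove μ ν c π₀, TransportBidual.Bidual (Lp ℝ 1 π.1),
      TransportBidual.IsProjectiveFamily H ∧
      ∀ π : TransportBidual.PlansAbove μ ν c π₀,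
        H π ∈ TransportBidual.bidualL1S μ ν π.1 ∧
        TransportBidual.BidualLE (H π)
          (TransportBidual.toBidual (TransportBidual.costL1 c hc π.2.1.2)) ∧
        (TransportBidual.pairing (H π) : EReal) =
          TransportBidual.dualBidual μ ν c hc π.1 π.2.1.2 ∧
        (∃! p : Lp ℝ 1 π.1 × TransportBidual.Bidual (Lp ℝ 1 π.1),
          TransportBidual.IsRegularSingular (H π) p.1 p.2) ∧
        ∀ (r : Lp ℝ 1 π.1) (s : TransportBidual.Bidual (Lp ℝ 1 π.1)),
          TransportBidual.IsRegularSingular (H π) r s →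
            r ≤ TransportBidual.costL1 c hc π.2.1.2 ∧ TransportBidual.BidualLE s 0) ∧
    (∀ π : TransportBidual.PlansAbove μ ν c π₀,
      Tendsto (TransportBidual.dualEps μ ν c π.1) (𝓝[>] (0 : ℝ))
        (𝓝 (TransportBidual.dualAt μ ν c π.1)) ∧
      TransportBidual.dualBidual μ ν c hc π.1 π.2.1.2 = TransportBidual.dualAt μ ν c π.1 ∧
      TransportBidual.dualAt μ ν c π.1 = (TransportBidual.primalAt μ ν c π.1 : EReal) ∧
      TransportBidual.primalAt μ ν c π.1 = TransportBidual.primalAt μ ν c π₀) ∧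
    (LowerSemicontinuous c → TransportBidual.PrimalAttained μ ν c) ∧
    (TransportBidual.PrimalAttained μ ν c →
      ∀ π : TransportBidual.PlansAbove μ ν c π₀,
        TransportBidual.dualBidual μ ν c hc π.1 π.2.1.2 = (TransportBidual.primal μ ν c : EReal) ∧
        TransportBidual.dualAt μ ν c π.1 = (TransportBidual.primal μ ν c : EReal) ∧
        TransportBidual.primalAt μ ν c π.1 = TransportBidual.primal μ ν c) := by
  have hPtop : primalAt μ ν c π₀ ≠ ∞ := ne_top_of_le_ne_top hπ₀.2 (primalAt_le_lintegral hπ₀.1)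
  have heq := primalAt_eq hπ₀ hmin
  obtain ⟨H, hproj, hH⟩ := exists_projectiveFamily (p := (primalAt μ ν c π₀).toReal) hc hπ₀
    fun π π' hπ' hle => by
      rw [ENNReal.ofReal_toReal hPtop, ← heq π]
      exact iInf₂_le π' ⟨hπ', hle⟩
  have hfeas : ∀ π : PlansAbove μ ν c π₀, H π ∈ bidualFeasible μ ν c hc π.1 π.2.1.2 := fun π =>
    ⟨(mem_range_bidualMap_subtypeL _ _).2 (hH π).1, (hH π).2.1⟩
  have hpair : ∀ π : PlansAbove μ ν c π₀,
      (pairing (H π) : EReal) = (primalAt μ ν c π.1 : EReal) := fun π => by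
    rw [(hH π).2.2, heq π, ← EReal.coe_ennreal_toReal hPtop]
  have hbidual : ∀ π : PlansAbove μ ν c π₀,
      dualBidual μ ν c hc π.1 π.2.1.2 = (primalAt μ ν c π.1 : EReal) := fun π =>
    le_antisymm (dualBidual_le_primalAt hc π.2.1)
      ((hpair π).symm.le.trans (le_iSup₂ (f := fun h _ => (pairing h : EReal)) (H π) (hfeas π)))
  have hlim := fun π : PlansAbove μ ν c π₀ => tendsto_dualEps hc π.2.1 (hfeas π) (hpair π)
  have hdual : ∀ π : PlansAbove μ ν c π₀,
      dualAt μ ν c π.1 = (primalAt μ ν c π.1 : EReal) := fun π => (hlim π).limUnder_eq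
  refine ⟨⟨H, hproj, fun π => ⟨(hfeas π).1, (hfeas π).2, (hpair π).trans (hbidual π).symm,
    regularSingular_of_le (hfeas π).2⟩⟩, fun π => ⟨?_, (hbidual π).trans (hdual π).symm, hdual π,
    heq π⟩, primalAttained_of_lowerSemicontinuous, fun hatt π => ?_⟩
  · rw [hdual π]
    exact hlim π
  · have hP := (heq π).trans (primal_eq_primalAt hπ₀ hmin hatt)
    exact ⟨by rw [hbidual π, hP], by rw [hdual π, hP], hP⟩
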